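/- Let $T>0$ and $p>1$. **Assumptions on an edge cost.** Let $I=[0,\infty)$ or $I=[0,l]$ with $l>0$. A running cost on $I$ is a function $\ell\in C(I\times\mathbb R\times[0,T])$, $(y,a,s)\mapsto \ell(y,a,s)$, such that $\ell(\cdot,\cdot,s)$ is differentiable on $I\times\mathbb R$ for each $s$, with $\partial_y\ell$, $\partial_a\ell$ continuous on $I\times\mathbb R\times[0,T]$. It satisfies [H1]–[H4] with constants $C_0>0$, $c_0\in\mathbb R$ if - [H1] $\ell(y,a,s)\ge C_0|a|^p+c_0$ for all $(y,a,s)$; - [H2] for every $r>0$ there is a modulus of continuity $\omega_r$ with $|\ell(y,a,t_1)-\ell(y,a,t_2)|\le(1+|a|^p)\,\omega_r(|t_1-t_2|)$ for $y\in I\cap[0,r]$, $a\in\mathbb R$, $t_1,t_2\in[0,T]$; - [H3] for every $r>0$ there is $\tilde c(r)\ge0$ with $|\partial_y\ell|\le\tilde c(r)(|a|^p+1)$ and $|\partial_a\ell|\le\tilde c(r)(|a|^{p-1}+1)$ for $y\in I\cap[0,r]$, $a\in\mathbb R$, $s\in[0,T]$; - [H4] $a\mapsto\ell(y,a,s)$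 is strictly convex. **Control problem.** Given $S\subset\mathbb R^k$, $x\in S$ and $t\in[0,T]$, let $\Gamma_t[x]$ be the set of $y\in C([t,T];S)\cap W^{1,p}(t,T;\mathbb R^k)$ with $y(t)=x$. Given a running cost $L$ and a terminal cost $g$, set $J_t(x;y)=\int_t^T L(y(\tau),y'(\tau),\tau)\,d\tau+g(y(T))$, $u(x,t)=\inf_{y\in\Gamma_t[x]}J_t(x;y)$, and let $\Gamma^{\rm opt}_t[x]$ be the set of $y\in\Gamma_t[x]$ with $J_t(x;y)=u(x,t)$. **(A) Junction.** Let $N>1$, $J_i=\mathbb R_+e_i\subset\mathbb R^N$ ($e_i$ the canonical basis) and $S=\mathcal G=\bigcup_{i=1}^N J_i$. Let $\ell_1,\dots,\ell_N$ be running costs on $[0,\infty)$ satisfying [H1]–[H4] with common constants $C_0,c_0$; let $\ell_*\in C([0,T])$ with $\ell_*\ge c_0$; let $g_1,\dots,g_N$ be bounded continuous functions on $[0,\infty)$ and $g_*\in\mathbb R$. Put $$L(y,\alpha,\tau)=\ell_i(|y|,\bar\alpha,\tau)\ \text{ if } y\in J_i\setminus\{0\},\ \alpha=\bar\alpha e_i,\qquad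 L(0,\alpha,\tau)=\min\{\ell_*(\tau),\min_i\ell_i(0,0,\tau)\},$$ $$g(y)=g_i(|y|)\ \text{ if } y\in J_i\setminus\{0\},\qquad g(0)=\min\{g_*,\min_i g_i(0)\}$$ (along $y\in\Gamma_t[x]$, $y'(\tau)$ is a multiple of $e_i$ for almost every $\tau$ with $y(\tau)\in J_i\setminus\{0\}$). Then: 1. for all $(x,t)\in\mathcal G\times[0,T]$, the integral defining $J_t(x;y)$ converges absolutely for every $y\in\Gamma_t[x]$, and $u(x,t)>-\infty$; 2. for all $(x,t)\in\mathcal G\times[0,T]$, $\Gamma^{\rm opt}_t[x]\neq\emptyset$, i.e. there is $y\in\Gamma_t[x]$ with $u(x,t)=J_t(x;y)$; 3. there are positive numbers $M(|x|)$ and $R(|x|)$, depending on $x$ only through $|x|$ and not on $t$, such that for all $(x,t)\in\mathcal G\times[0,T]$ every $y\in\Gamma^{\rm opt}_t[x]$ satisfies $\|y\|_{W^{1,p}(t,T;\mathbb R^N)}\le M(|x|)$ and $\max_{s\in[t,T]}|y(s)|\le R(|x|)$. **(B) General networks.** Let $\mathcal N\subset\mathbb R^d$ be a connected set which is the union of finitely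 many straight edges $J_1,\dots,J_m$ and contains finitely many distinct points $O_1,\dots,O_n$ (the vertices). Each edge $J_i$ starts at a vertex $O$, has a unit direction $\nu_i$ and a length $l_i\in(0,\infty]$, and is parametrized by $\pi_i(s)=O+s\nu_i$, $0\le s\le l_i$ ($0\le s<\infty$ if $l_i=\infty$); if $l_i<\infty$, then $\pi_i(l_i)$ is a vertex too. Two different edges are disjoint or meet in exactly one point, which is a vertex. Let $\ell_i$ be running costs on the parameter interval of $J_i$ satisfying [H1]–[H4] with common constants $C_0,c_0$; let $\ell_{*j}\in C([0,T])$ with $\ell_{*j}\ge c_0$; let $g_i$ be bounded continuous functions on the parameter interval of $J_i$ and $g_{*j}\in\mathbb R$. With $\mathcal V=\{O_1,\dots,O_n\}$ put $$L(y,\alpha,\tau)=\ell_i(\pi_i^{-1}(y),\alpha\cdot\nu_i,\tau)\ \text{ if } y\in J_i\setminus\mathcal V,\qquad L(O_j,\alpha,\tau)=\min\Bigl\{\ell_{*j}(\tau),\min_{i:\,O_j\in J_i}\ell_i(\pi_i^{-1}(O_j),0,\tau)\Bigr\},$$ $$g(y)=g_i(\pi_i^{-1}(y))\ \text{ if } y\in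 J_i\setminus\mathcal V,\qquad g(O_j)=\min\Bigl\{g_{*j},\min_{i:\,O_j\in J_i}g_i(\pi_i^{-1}(O_j))\Bigr\}.$$ Then conclusions 1–3 hold with $\mathcal G$ replaced by $S=\mathcal N$ (and $\mathbb R^N$ by $\mathbb R^d$). -/

import Mathlib

open Set Filter Topology MeasureTheory
open scoped ENNReal

noncomputable section

namespace NetControl

/-! ### Weak derivatives and the Sobolev space `W^{1,p}(a, b; E)` -/

section Sobolev

variable {E : Type*} [NormedAddCommGroup E] [NormedSpace ℝ E]

/-- `v ∈ L¹_loc(a, b; E)` is a weak derivative of `y ∈ L¹_loc(a, b; E)` on the interval `(a, b)`. -/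
def HasWeakDeriv (a b : ℝ) (y v : ℝ → E) : Prop :=
  LocallyIntegrableOn y (Ioo a b) ∧ LocallyIntegrableOn v (Ioo a b) ∧
  ∀ φ : ℝ → ℝ, ContDiff ℝ (⊤ : ℕ∞) φ → HasCompactSupport φ → tsupport φ ⊆ Ioo a b →
    ∫ s in Ioo a b, deriv φ s • y s = -∫ s in Ioo a b, φ s • v s

open Classical in
/-- The weak derivative `y'` of `y` on `(a, b)` (a representative of it; `0` if there is none). -/
def weakDeriv (a b : ℝ) (y : ℝ → E) : ℝ → E :=
  if h : ∃ v, HasWeakDeriv a b y v then h.choose else 0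

/-- `y ∈ W^{1,p}(a, b; E)`. -/
def MemW1p (p a b : ℝ) (y : ℝ → E) : Prop :=
  MemLp y (ENNReal.ofReal p) (volume.restrict (Ioo a b)) ∧
  ∃ v, HasWeakDeriv a b y v ∧ MemLp v (ENNReal.ofReal p) (volume.restrict (Ioo a b))

/-- `‖y‖_{W^{1,p}(a,b;E)} = (‖y‖_{L^p}^p + ‖y'‖_{L^p}^p)^{1/p}`, as an extended real. -/
def normW1p (p a b : ℝ) (y : ℝ → E) : ℝ≥0∞ :=
  (eLpNorm y (ENNReal.ofReal p) (volume.restrict (Ioo a b)) ^ p +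
    eLpNorm (weakDeriv a b y) (ENNReal.ofReal p) (volume.restrict (Ioo a b)) ^ p) ^ (1 / p)

/-! ### The optimal control problem on a state space `S`

Trajectories are functions on `ℝ` of which only the values on `[t, T]` matter. -/

/-- `Γ_t[x]`: the trajectories `y ∈ C([t,T]; S) ∩ W^{1,p}(t,T; E)` with `y(t) = x`. -/
def admissible (S : Set E) (p T t : ℝ) (x : E) : Set (ℝ → E) :=
  {y | ContinuousOn y (Icc t T) ∧ MapsTo y (Icc t T) S ∧ MemW1p p t T y ∧ y t = x}

/-- `J_t(x; y) = ∫_t^T L(y, y', τ) dτ + g(y(T))`. -/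
def cost (L : E → E → ℝ → ℝ) (g : E → ℝ) (T t : ℝ) (y : ℝ → E) : ℝ :=
  (∫ τ in Ioo t T, L (y τ) (weakDeriv t T y τ) τ) + g (y T)

/-- `u(x, t) = inf_{y ∈ Γ_t[x]} J_t(x; y)`. -/
def value (S : Set E) (L : E → E → ℝ → ℝ) (g : E → ℝ) (p T : ℝ) (x : E) (t : ℝ) : ℝ :=
  sInf (cost L g T t '' admissible S p T t x)

/-- `Γ_t^opt[x]`: the trajectories that achieve `u(x, t)`. -/
def optimal (S : Set E) (L : E → E → ℝ → ℝ) (g : E → ℝ) (p T t : ℝ) (x : E) : Set (ℝ → E) :=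
  {y | y ∈ admissible S p T t x ∧ cost L g T t y = value S L g p T x t}

end Sobolev

/-! ### Assumptions on the costs -/

/-- The regularity assumptions and [H1]-[H4] on the running cost `ℓ(y, a, s)` of one edge, where
`y ∈ I` is the position on the edge, `a ∈ ℝ` the velocity and `s ∈ [0, T]` the time. -/
structure EdgeCostAssumptions (p T C₀ c₀ : ℝ) (I : Set ℝ) (ℓ : ℝ → ℝ → ℝ → ℝ) : Prop where
  continuousOn : ContinuousOn (fun q : ℝ × ℝ × ℝ => ℓ q.1 q.2.1 q.2.2) (I ×ˢ univ ×ˢ Icc 0 T)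
  differentiableOn : ∀ s ∈ Icc 0 T,
    DifferentiableOn ℝ (fun q : ℝ × ℝ => ℓ q.1 q.2 s) (I ×ˢ univ)
  continuousOn_dy : ContinuousOn
    (fun q : ℝ × ℝ × ℝ => derivWithin (fun y => ℓ y q.2.1 q.2.2) I q.1) (I ×ˢ univ ×ˢ Icc 0 T)
  continuousOn_da : ContinuousOn
    (fun q : ℝ × ℝ × ℝ => deriv (fun a => ℓ q.1 a q.2.2) q.2.1) (I ×ˢ univ ×ˢ Icc 0 T)
  h1 : ∀ y ∈ I, ∀ a, ∀ s ∈ Icc 0 T, C₀ * |a| ^ p + c₀ ≤ ℓ y a s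
  h2 : ∀ r > 0, ∃ w : ℝ → ℝ, Tendsto w (𝓝[≥] 0) (𝓝 0) ∧
    ∀ y ∈ I, y ≤ r → ∀ a, ∀ t₁ ∈ Icc 0 T, ∀ t₂ ∈ Icc 0 T,
      |ℓ y a t₁ - ℓ y a t₂| ≤ (1 + |a| ^ p) * w |t₁ - t₂|
  h3 : ∀ r > 0, ∃ c : ℝ, 0 ≤ c ∧ ∀ y ∈ I, y ≤ r → ∀ a, ∀ s ∈ Icc 0 T,
    |derivWithin (fun y' => ℓ y' a s) I y| ≤ c * (|a| ^ p + 1) ∧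
    |deriv (fun a' => ℓ y a' s) a| ≤ c * (|a| ^ (p - 1) + 1)
  h4 : ∀ y ∈ I, ∀ s ∈ Icc 0 T, StrictConvexOn ℝ univ (fun a => ℓ y a s)

/-- `f ∈ C_b(I)`. -/
def IsCb (I : Set ℝ) (f : ℝ → ℝ) : Prop :=
  ContinuousOn f I ∧ ∃ C, ∀ y ∈ I, |f y| ≤ C

/-! ### The junction -/

/-- The edge `J_i = ℝ₊ e_i` of the junction with `N` edges. -/
def junctionEdge {N : ℕ} (i : Fin N) : Set (EuclideanSpace ℝ (Fin N)) :=
  {z | ∃ r : ℝ, 0 ≤ r ∧ z = EuclideanSpace.single i r}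

/-- The junction `𝒢 = J_1 ∪ ... ∪ J_N ⊆ ℝ^N`. -/
def junction (N : ℕ) : Set (EuclideanSpace ℝ (Fin N)) := ⋃ i, junctionEdge i

/-- Cost functions on the junction: running costs `ℓ_i` and terminal costs `g_i` on the edges, and
specific costs `ℓ_*`, `g_*` at the vertex. -/
structure JunctionCosts (N : ℕ) where
  ℓ : Fin N → ℝ → ℝ → ℝ → ℝ
  ℓstar : ℝ → ℝ
  g : Fin N → ℝ → ℝ
  gstar : ℝ

namespace JunctionCosts

variable {N : ℕ} (c : JunctionCosts N)

/-- The cost `ℓ_0(τ) = min {ℓ_*(τ), min_i ℓ_i(0, 0, τ)}` for staying at the vertex. -/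
def vertexCost (τ : ℝ) : ℝ := min (c.ℓstar τ) (⨅ i, c.ℓ i 0 0 τ)

/-- The running cost `L(z, a, τ)`. For a trajectory `y` with `y(τ) ∈ J_i ∖ {0}`, the signed scalar
velocity `|y|'(τ)` is the `i`-th coordinate of `y'(τ)`. -/
def runningCost (z a : EuclideanSpace ℝ (Fin N)) (τ : ℝ) : ℝ :=
  (∑ i, (junctionEdge i \ {0}).indicator (fun z' => c.ℓ i ‖z'‖ (a i) τ) z) +
    ({0} : Set (EuclideanSpace ℝ (Fin N))).indicator (fun _ => c.vertexCost τ) z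

/-- The terminal cost, equal to `min {g_*, min_i g_i(0)}` at the vertex. -/
def terminalCost (z : EuclideanSpace ℝ (Fin N)) : ℝ :=
  (∑ i, (junctionEdge i \ {0}).indicator (fun z' => c.g i ‖z'‖) z) +
    ({0} : Set (EuclideanSpace ℝ (Fin N))).indicator (fun _ => min c.gstar (⨅ i, c.g i 0)) z

/-- The standing assumptions on the costs. -/
structure Assumptions (p T : ℝ) : Prop where
  edge : ∃ C₀ c₀ : ℝ, 0 < C₀ ∧ (∀ i, EdgeCostAssumptions p T C₀ c₀ (Ici 0) (c.ℓ i)) ∧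
    ∀ s ∈ Icc 0 T, c₀ ≤ c.ℓstar s
  star : ContinuousOn c.ℓstar (Icc 0 T)
  terminal : ∀ i, IsCb (Ici 0) (c.g i)

end JunctionCosts

/-! ### General networks -/

/-- The data of a network in `ℝ^d` with `n` vertices and `m` straight edges: the `i`-th edge starts at
the vertex number `src i`, has the direction `dir i` and the length `len i`. -/
structure Network (d n m : ℕ) where
  vertex : Fin n → EuclideanSpace ℝ (Fin d)
  src : Fin m → Fin n
  dir : Fin m → EuclideanSpace ℝ (Fin d)
  len : Fin m → ℝ≥0∞

namespace Network

variable {d n m : ℕ} (G : Network d n m)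

/-- The domain of `π_i`: `[0, l_i]`, or `[0, ∞)` if `l_i = ∞`. -/
def dom (i : Fin m) : Set ℝ := {s | 0 ≤ s ∧ ENNReal.ofReal s ≤ G.len i}

/-- The natural (arc length) parametrization `π_i` of the `i`-th edge. -/
def param (i : Fin m) (s : ℝ) : EuclideanSpace ℝ (Fin d) := G.vertex (G.src i) + s • G.dir i

/-- The closed edge `J_i`. -/
def edge (i : Fin m) : Set (EuclideanSpace ℝ (Fin d)) := G.param i '' G.dom i

/-- The network as a subset of `ℝ^d`. -/
def carrier : Set (EuclideanSpace ℝ (Fin d)) := ⋃ i, G.edge i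

/-- The inverse `π_i⁻¹` of the parametrization (see `coord_param`). -/
def coord (i : Fin m) (z : EuclideanSpace ℝ (Fin d)) : ℝ :=
  inner ℝ (G.dir i) (z - G.vertex (G.src i))

/-- The data form a network: the vertices are distinct and lie on the edges, the directions are unit
vectors, the lengths lie in `(0, ∞]`, an edge of finite length also ends at a vertex, two different
edges are disjoint or meet in exactly one vertex, and the union of the edges is connected. -/
structure Valid : Prop where
  vertex_injective : Function.Injective G.vertex
  vertex_mem : ∀ k, G.vertex k ∈ G.carrier
  norm_dir : ∀ i, ‖G.dir i‖ = 1
  len_pos : ∀ i, 0 < G.len i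
  exists_end : ∀ i, G.len i ≠ ∞ → ∃ k, G.vertex k = G.param i (G.len i).toReal
  inter_edge : ∀ i j, i ≠ j →
    G.edge i ∩ G.edge j = ∅ ∨ ∃ k, G.edge i ∩ G.edge j = {G.vertex k}
  connected : IsConnected G.carrier

theorem coord_param (h : G.Valid) (i : Fin m) (s : ℝ) : G.coord i (G.param i s) = s := by
  simp [coord, param, inner_smul_right, h.norm_dir i]

end Network

/-- Cost functions on a network with `n` vertices and `m` edges: running costs `ℓ_i` and terminal
costs `g_i` on the edges, and specific costs `ℓ_{*j}`, `g_{*j}` at the vertices. -/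
structure NetworkCosts (n m : ℕ) where
  ℓ : Fin m → ℝ → ℝ → ℝ → ℝ
  ℓstar : Fin n → ℝ → ℝ
  g : Fin m → ℝ → ℝ
  gstar : Fin n → ℝ

namespace NetworkCosts

variable {d n m : ℕ} (c : NetworkCosts n m) (G : Network d n m)

/-- The cost `min {ℓ_{*j}(τ), min_{i : O_j ∈ J_i} ℓ_i(π_i⁻¹(O_j), 0, τ)}` for staying at `O_j`. -/
def vertexCost (j : Fin n) (τ : ℝ) : ℝ :=
  min (c.ℓstar j τ)
    (⨅ i : {i : Fin m // G.vertex j ∈ G.edge i}, c.ℓ i.1 (G.coord i.1 (G.vertex j)) 0 τ)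

/-- The running cost `L(z, a, τ)`. For a trajectory `y` with `y(τ)` in `J_i` and not a vertex, the
signed scalar velocity `(π_i⁻¹ ∘ y)'(τ)` is `⟪dir i, y'(τ)⟫`. -/
def runningCost (z a : EuclideanSpace ℝ (Fin d)) (τ : ℝ) : ℝ :=
  (∑ i, (G.edge i \ range G.vertex).indicator
      (fun z' => c.ℓ i (G.coord i z') (inner ℝ (G.dir i) a) τ) z) +
    ∑ j, ({G.vertex j} : Set (EuclideanSpace ℝ (Fin d))).indicator
      (fun _ => c.vertexCost G j τ) z

/-- The terminal cost, equal to `min {g_{*j}, min_{i : O_j ∈ J_i} g_i(π_i⁻¹(O_j))}` at `O_j`. -/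
def terminalCost (z : EuclideanSpace ℝ (Fin d)) : ℝ :=
  (∑ i, (G.edge i \ range G.vertex).indicator (fun z' => c.g i (G.coord i z')) z) +
    ∑ j, ({G.vertex j} : Set (EuclideanSpace ℝ (Fin d))).indicator
      (fun _ => min (c.gstar j)
        (⨅ i : {i : Fin m // G.vertex j ∈ G.edge i}, c.g i.1 (G.coord i.1 (G.vertex j)))) z

/-- The standing assumptions on the costs. -/
structure Assumptions (p T : ℝ) : Prop where
  edge : ∃ C₀ c₀ : ℝ, 0 < C₀ ∧ (∀ i, EdgeCostAssumptions p T C₀ c₀ (G.dom i) (c.ℓ i)) ∧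
    ∀ j, ∀ s ∈ Icc 0 T, c₀ ≤ c.ℓstar j s
  star : ∀ j, ContinuousOn (c.ℓstar j) (Icc 0 T)
  terminal : ∀ i, IsCb (G.dom i) (c.g i)

end NetworkCosts

end NetControl

end

open NetControl

namespace NetControl

/-! ### Absolutely continuous paths -/

section Paths

/-! This is the direct method, adapted to a running cost that is discontinuous at the vertices. A
trajectory has zero velocity at almost every time spent at a vertex (`ae_deriv_eq_zero_of_eq`), so
the coercive bound `C₀ * ‖v‖ ^ p + c₀ ≤ L` holds almost everywhere along every trajectory.
Comparison with the constant trajectory bounds the value from above, and coercivity turns this into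
the bounds on optimal trajectories (`CostBounds.exists_bounds`).

For existence, take a minimizing sequence `Y k` and its cumulative excess costs `∫ (L - c₀)` over
`t..s`, which are nondecreasing in `s` and bounded. Along an ultrafilter both converge at every
time, to `y` and `F`. Since `‖v‖ ≤ Λ + δ * (L - c₀)` with `δ` as small as desired, `y` is absolutely
continuous; `F` is monotone. Hence both are differentiable almost everywhere, and it suffices to
prove `L(y, y', s) - c₀ ≤ F'(s)` there, because `∫ F' ≤ F T - F t`.

This pointwise inequality (`runningCost_le_of_hasDerivAt`) is a calibration argument that needs no
weak convergence of velocities. Near `z₀ = y s`, convexity, coercivity and continuity bound the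
running cost below by a function affine in the velocity, with its own slope `q i` on each edge
(`CostBounds.exists_eventually_le_runningCost`). If `z₀` is a vertex, the minimum in the definition
of the vertex cost is exactly what makes this possible. Along a trajectory that meets no vertex
other than `z₀`, the affine function is the derivative of a combination of the functions `branch i
z₀` (`isPrimitive_branch`). Its integral therefore depends only on endpoint values, which pass to
the limit; differentiating at `s` from the right gives the claim. The terminal cost is lower
semicontinuous, again by the minimum at the vertices.

The junction is the network with one vertex and infinite edges. -/

theorem absolutelyContinuousOnInterval_of_dist_le {X Y : Type*} [PseudoMetricSpace X]
    [PseudoMetricSpace Y] {f : ℝ → X} {g : ℝ → Y} {a b : ℝ}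
    (hg : AbsolutelyContinuousOnInterval g a b)
    (h : ∀ r ∈ uIcc a b, ∀ s ∈ uIcc a b, dist (f r) (f s) ≤ dist (g r) (g s)) :
    AbsolutelyContinuousOnInterval f a b := by
  rw [absolutelyContinuousOnInterval_iff] at hg ⊢
  intro ε hε
  obtain ⟨δ, hδ, H⟩ := hg ε hε
  refine ⟨δ, hδ, fun I hI hlen => (Finset.sum_le_sum fun i hi => ?_).trans_lt (H I hI hlen)⟩
  exact h _ (hI.1 i hi).1 _ (hI.1 i hi).2

variable {E : Type*} [NormedAddCommGroup E] [NormedSpace ℝ E] {a b : ℝ} {y v : ℝ → E}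

/-- `y` is a primitive of the integrable function `v` on `[a, b]`. -/
structure IsPrimitive (a b : ℝ) (y v : ℝ → E) : Prop where
  intervalIntegrable : IntervalIntegrable v volume a b
  sub_eq : ∀ r ∈ Icc a b, ∀ s ∈ Icc a b, y s - y r = ∫ τ in r..s, v τ

theorem isPrimitive_integral (hv : IntervalIntegrable v volume a b) (hab : a ≤ b) (c : E) :
    IsPrimitive a b (fun s => c + ∫ τ in a..s, v τ) v := by
  refine ⟨hv, fun r hr s hs => ?_⟩
  rw [← uIcc_of_le hab] at hr hs
  rw [add_sub_add_left_eq_sub, intervalIntegral.integral_interval_sub_left]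
  · exact hv.mono_set (uIcc_subset_uIcc_left hs)
  · exact hv.mono_set (uIcc_subset_uIcc_left hr)

namespace IsPrimitive

theorem mono (h : IsPrimitive a b y v) {c d : ℝ} (hcd : c ≤ d) (hsub : Icc c d ⊆ Icc a b) :
    IsPrimitive c d y v := by
  have hc := hsub ⟨le_rfl, hcd⟩
  refine ⟨h.intervalIntegrable.mono_set ?_, fun r hr s hs => h.sub_eq r (hsub hr) s (hsub hs)⟩
  rwa [uIcc_of_le hcd, uIcc_of_le (hc.1.trans hc.2)]

theorem norm_sub_le (h : IsPrimitive a b y v) {r s : ℝ} (hr : r ∈ Icc a b) (hs : s ∈ Icc a b)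
    (hrs : r ≤ s) : ‖y s - y r‖ ≤ ∫ τ in r..s, ‖v τ‖ := by
  rw [h.sub_eq r hr s hs]
  exact intervalIntegral.norm_integral_le_integral_norm hrs

/-- The increments of `f` are dominated by those of the scalar primitive of `‖v‖`, which is
absolutely continuous. This serves for `branch` along a path, where no velocity is known beforehand.
-/
theorem absolutelyContinuous_of_le {X : Type*} [PseudoMetricSpace X] {f : ℝ → X}
    (h : IsPrimitive a b y v) (hab : a ≤ b)
    (hf : ∀ r ∈ Icc a b, ∀ s ∈ Icc a b, r ≤ s → dist (f r) (f s) ≤ ∫ τ in r..s, ‖v τ‖) :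
    AbsolutelyContinuousOnInterval f a b := by
  have hn := h.intervalIntegrable.norm
  refine absolutelyContinuousOnInterval_of_dist_le
    (hn.absolutelyContinuousOnInterval_intervalIntegral (c := a) left_mem_uIcc) ?_
  have key : ∀ r ∈ Icc a b, ∀ s ∈ Icc a b, r ≤ s →
      dist (f r) (f s) ≤ dist (∫ τ in a..r, ‖v τ‖) (∫ τ in a..s, ‖v τ‖) := by
    intro r hr s hs hrs
    refine (hf r hr s hs hrs).trans ?_
    rw [dist_comm, Real.dist_eq, intervalIntegral.integral_interval_sub_left]
    · exact le_abs_self _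
    · exact hn.mono_set (by rw [← uIcc_of_le hab] at hs; exact uIcc_subset_uIcc_left hs)
    · exact hn.mono_set (by rw [← uIcc_of_le hab] at hr; exact uIcc_subset_uIcc_left hr)
  intro r hr s hs
  rw [uIcc_of_le hab] at hr hs
  rcases le_total r s with hrs | hrs
  · exact key r hr s hs hrs
  · rw [dist_comm (f r), dist_comm (∫ τ in a..r, ‖v τ‖)]
    exact key s hs r hr hrs

theorem absolutelyContinuous (h : IsPrimitive a b y v) (hab : a ≤ b) :
    AbsolutelyContinuousOnInterval y a b :=
  h.absolutelyContinuous_of_le hab fun r hr s hs hrs => by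
    rw [dist_comm, dist_eq_norm]; exact h.norm_sub_le hr hs hrs

theorem continuousOn (h : IsPrimitive a b y v) (hab : a ≤ b) : ContinuousOn y (Icc a b) := by
  have := (h.absolutelyContinuous hab).continuousOn
  rwa [uIcc_of_le hab] at this

theorem ae_hasDerivAt [CompleteSpace E] (h : IsPrimitive a b y v) (hab : a ≤ b) :
    ∀ᵐ s, s ∈ Ioo a b → HasDerivAt y (v s) s := by
  filter_upwards [h.intervalIntegrable.ae_hasDerivAt_integral] with s hs hsI
  have h1 := hs (by rw [uIcc_of_le hab]; exact Ioo_subset_Icc_self hsI) a left_mem_uIcc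
  refine (h1.const_add (y a)).congr_of_eventuallyEq ?_
  filter_upwards [Icc_mem_nhds hsI.1 hsI.2] with r hr
  rw [← h.sub_eq a ⟨le_rfl, hab⟩ r hr]
  abel

end IsPrimitive

/-- The fundamental theorem of calculus for vector valued absolutely continuous functions. -/
theorem isPrimitive_of_absolutelyContinuous [CompleteSpace E]
    (hy : AbsolutelyContinuousOnInterval y a b) (hab : a ≤ b)
    (hv : IntervalIntegrable v volume a b)
    (hd : ∀ᵐ s, s ∈ Ioo a b → HasDerivAt y (v s) s) : IsPrimitive a b y v := by
  have hP := isPrimitive_integral hv hab (0 : E)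
  -- The difference of `y` and the primitive of `v` is absolutely continuous with derivative zero
  -- almost everywhere, hence constant.
  have hac := hy.sub (hP.absolutelyContinuous hab)
  obtain ⟨C, hC⟩ := hac.const_of_ae_hasDerivAt_zero (by
    have h1 : ∀ᵐ x : ℝ, x ≠ a := by simp [ae_iff, measure_singleton]
    have h2 : ∀ᵐ x : ℝ, x ≠ b := by simp [ae_iff, measure_singleton]
    filter_upwards [hd, hP.ae_hasDerivAt hab, h1, h2] with s hs hs' ha hb hsI
    rw [uIcc_of_le hab] at hsI
    have hI : s ∈ Ioo a b := ⟨lt_of_le_of_ne hsI.1 (Ne.symm ha), lt_of_le_of_ne hsI.2 hb⟩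
    simpa using! (hs hI).sub (hs' hI))
  refine ⟨hv, fun r hr s hs => ?_⟩
  rw [← hP.sub_eq r hr s hs]
  rw [← uIcc_of_le hab] at hr hs
  have h1 := hC r hr
  have h2 := hC s hs
  have h3 := h1.trans h2.symm
  simp only [Pi.sub_apply] at h3
  rw [sub_eq_sub_iff_sub_eq_sub] at h3
  rw [← neg_sub (y r), h3, neg_sub]

/-! ### Weak derivatives versus primitives. -/

/-- Integration by parts: the product `φ • y` is absolutely continuous and vanishes at both
endpoints. -/
theorem IsPrimitive.hasWeakDeriv [CompleteSpace E] (h : IsPrimitive a b y v) (hab : a ≤ b) :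
    HasWeakDeriv a b y v := by
  refine ⟨((h.continuousOn hab).mono Ioo_subset_Icc_self).locallyIntegrableOn measurableSet_Ioo,
    ((intervalIntegrable_iff_integrableOn_Ioo_of_le hab).1
      h.intervalIntegrable).locallyIntegrableOn, fun φ hφ _ hsupp => ?_⟩
  have hφc : Continuous φ := hφ.continuous
  have hφd : Continuous (deriv φ) := hφ.continuous_deriv (by simp)
  have hac : AbsolutelyContinuousOnInterval (φ • y) a b :=
    ((hφ.of_le (by simp)).contDiffOn.absolutelyContinuousOnInterval).smul
      (h.absolutelyContinuous hab)
  have hycont := h.continuousOn hab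
  have hI1 : IntervalIntegrable (fun s => deriv φ s • y s) volume a b :=
    (hφd.continuousOn.smul (by rwa [uIcc_of_le hab])).intervalIntegrable
  have hI2 : IntervalIntegrable (fun s => φ s • v s) volume a b :=
    h.intervalIntegrable.continuousOn_smul hφc.continuousOn
  have hprim := isPrimitive_of_absolutelyContinuous (v := fun s => φ s • v s + deriv φ s • y s)
    hac hab (hI2.add hI1) (by
      filter_upwards [h.ae_hasDerivAt hab] with s hs hsI
      exact ((hφ.differentiable (by simp)) s).hasDerivAt.smul (hs hsI))
  have h0 := hprim.sub_eq a ⟨le_rfl, hab⟩ b ⟨hab, le_rfl⟩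
  have hz : ∀ c, c ∉ Ioo a b → φ c = 0 := fun c hc =>
    image_eq_zero_of_notMem_tsupport fun h' => hc (hsupp h')
  rw [Pi.smul_apply', Pi.smul_apply', hz a (by simp), hz b (by simp), zero_smul, zero_smul,
    sub_zero, intervalIntegral.integral_add hI2 hI1, intervalIntegral.integral_of_le hab,
    intervalIntegral.integral_of_le hab, integral_Ioc_eq_integral_Ioo,
    integral_Ioc_eq_integral_Ioo] at h0
  rw [eq_neg_iff_add_eq_zero, add_comm]
  exact h0.symm

/-- By the fundamental lemma of the calculus of variations. It makes the choice inside `weakDeriv`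
harmless. -/
theorem HasWeakDeriv.ae_eq [CompleteSpace E] {v' : ℝ → E} (h : HasWeakDeriv a b y v)
    (h' : HasWeakDeriv a b y v') : ∀ᵐ s, s ∈ Ioo a b → v s = v' s := by
  have := isOpen_Ioo.ae_eq_zero_of_integral_contDiff_smul_eq_zero (μ := volume)
    (f := fun s => v s - v' s) (h.2.1.sub h'.2.1) (U := Ioo a b) (fun φ hφ hc hs => by
      have hint : ∀ w : ℝ → E, LocallyIntegrableOn w (Ioo a b) →
          Integrable (fun s => φ s • w s) := by
        intro w hw
        have := (hw.integrableOn_compact_subset hs hc).continuousOn_smul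
          hφ.continuous.continuousOn hc
        exact (integrableOn_iff_integrable_of_support_subset
          ((Function.support_smul_subset_left _ _).trans subset_closure)).1 this
      have h0 : ∀ w : ℝ → E, ∫ s, φ s • w s = ∫ s in Ioo a b, φ s • w s := by
        intro w
        refine (setIntegral_eq_integral_of_forall_compl_eq_zero fun x hx => ?_).symm
        rw [image_eq_zero_of_notMem_tsupport fun h' => hx (hs h'), zero_smul]
      simp only [smul_sub]
      rw [integral_sub (hint _ h.2.1) (hint _ h'.2.1), h0, h0, sub_eq_zero, ← neg_inj,
        ← h.2.2 φ hφ hc hs, ← h'.2.2 φ hφ hc hs])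
  filter_upwards [this] with s hs hsI
  exact sub_eq_zero.1 (hs hsI)

/-- A function with integral zero has a compactly supported primitive. -/
theorem exists_compactSupport_primitive {η : ℝ → ℝ} (hη : ContDiff ℝ (⊤ : ℕ∞) η)
    (hc : HasCompactSupport η) (hs : tsupport η ⊆ Ioo a b) (hab : a < b)
    (h0 : ∫ s in Ioo a b, η s = 0) :
    ∃ φ : ℝ → ℝ, ContDiff ℝ (⊤ : ℕ∞) φ ∧ HasCompactSupport φ ∧ tsupport φ ⊆ Ioo a b ∧
      deriv φ = η := by
  have hcont := hη.continuous
  have hder : ∀ s, HasDerivAt (fun s => ∫ τ in a..s, η τ) (η s) s := fun s =>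
    intervalIntegral.integral_hasDerivAt_right (hcont.intervalIntegrable _ _)
      hcont.aestronglyMeasurable.stronglyMeasurableAtFilter hcont.continuousAt
  have hd : deriv (fun s => ∫ τ in a..s, η τ) = η := funext fun s => (hder s).deriv
  -- The primitive started at `a` vanishes to the left of `c` because `η` does, and to the right of
  -- `d` because the total integral is zero.
  obtain ⟨c, d, hac, hcd, hdb, hsub⟩ : ∃ c d, a < c ∧ c ≤ d ∧ d < b ∧ tsupport η ⊆ Icc c d := by
    rcases (tsupport η).eq_empty_or_nonempty with he | hne
    · exact ⟨(a + b) / 2, (a + b) / 2, by linarith, le_rfl, by linarith, by simp [he]⟩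
    · have hcomp : IsCompact (tsupport η) := hc
      have h1 := hcomp.sInf_mem hne
      have h2 := hcomp.sSup_mem hne
      exact ⟨_, _, (hs h1).1, csInf_le hcomp.bddBelow h2, (hs h2).2, fun x hx =>
        ⟨csInf_le hcomp.bddBelow hx, le_csSup hcomp.bddAbove hx⟩⟩
  have hz : ∀ s, s ∉ Icc c d → η s = 0 := fun s h => 
    image_eq_zero_of_notMem_tsupport fun h' => h (hsub h')
  have hsupp : Function.support (fun s => ∫ τ in a..s, η τ) ⊆ Icc c d := by
    intro s hs'
    by_contra hcon
    apply hs'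
    rcases lt_or_ge s c with h | h
    · refine (intervalIntegral.integral_congr (g := fun _ => (0 : ℝ)) fun τ hτ => ?_).trans (by simp)
      refine hz τ fun h' => ?_
      rcases mem_uIcc.1 hτ with h2 | h2
      · linarith [h'.1, h2.2]
      · linarith [h'.1, h2.2]
    · have hds : d < s := by
        by_contra! h2
        exact hcon ⟨h, h2⟩
      have hb : ∫ τ in a..b, η τ = 0 := by
        rw [intervalIntegral.integral_of_le hab.le, integral_Ioc_eq_integral_Ioo, h0]
      have : ∫ τ in s..b, η τ = 0 := by
        refine (intervalIntegral.integral_congr (g := fun _ => (0 : ℝ)) fun τ hτ => ?_).trans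
          (by simp)
        refine hz τ fun h' => ?_
        rcases mem_uIcc.1 hτ with h2 | h2
        · linarith [h'.2, h2.1]
        · linarith [h'.2, h2.1]
      have h3 := intervalIntegral.integral_add_adjacent_intervals (μ := volume)
        (hcont.intervalIntegrable a s) (hcont.intervalIntegrable s b)
      simp only
      linarith
  have hts : tsupport (fun s => ∫ τ in a..s, η τ) ⊆ Icc c d :=
    closure_minimal hsupp isClosed_Icc
  refine ⟨_, ?_, HasCompactSupport.of_support_subset_isCompact isCompact_Icc hsupp,
    hts.trans fun x hx => ⟨hac.trans_le hx.1, hx.2.trans_lt hdb⟩, hd⟩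
  exact contDiff_infty_iff_deriv.2 ⟨fun s => (hder s).differentiableAt, by rw [hd]; exact hη⟩

/-- The du Bois-Reymond lemma. -/
theorem HasWeakDeriv.ae_eq_const [CompleteSpace E] (hab : a < b) (h : HasWeakDeriv a b y 0) :
    ∃ c : E, ∀ᵐ s, s ∈ Ioo a b → y s = c := by
  let B : ContDiffBump ((a + b) / 2) := ⟨(b - a) / 8, (b - a) / 4, by linarith, by linarith⟩
  let β : ℝ → ℝ := B.normed volume
  have hβ : ContDiff ℝ (⊤ : ℕ∞) β := B.contDiff_normed
  have hβc : HasCompactSupport β := B.hasCompactSupport_normed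
  have hβs : tsupport β ⊆ Ioo a b := by
    rw [ContDiffBump.tsupport_normed_eq, Real.closedBall_eq_Icc]
    exact fun x hx => ⟨by have := hx.1; simp only [B] at this; linarith,
      by have := hx.2; simp only [B] at this; linarith⟩
  have hβ1 : ∫ s in Ioo a b, β s = 1 := by
    rw [← B.integral_normed (μ := volume)]
    exact setIntegral_eq_integral_of_forall_compl_eq_zero fun x hx =>
      image_eq_zero_of_notMem_tsupport fun h' => hx (hβs h')
  have hint : ∀ (ψ : ℝ → ℝ), Continuous ψ → HasCompactSupport ψ → tsupport ψ ⊆ Ioo a b →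
      IntegrableOn (fun s => ψ s • y s) (Ioo a b) := by
    intro ψ hψ hc hs
    have := (h.1.integrableOn_compact_subset hs hc).continuousOn_smul hψ.continuousOn hc
    exact ((integrableOn_iff_integrable_of_support_subset
      ((Function.support_smul_subset_left _ _).trans subset_closure)).1 this).integrableOn
  refine ⟨∫ s in Ioo a b, β s • y s, ?_⟩
  have := isOpen_Ioo.ae_eq_zero_of_integral_contDiff_smul_eq_zero (μ := volume)
    (f := fun s => y s - ∫ s in Ioo a b, β s • y s)
    (h.1.sub (locallyIntegrableOn_const _)) (U := Ioo a b) (fun ψ hψ hc hs => by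
      -- Subtracting `m` times the normalized bump `β` leaves a test function of integral zero,
      -- which is the derivative of a test function. The weak equation then reads `∫ ψ • y = m • ∫ β
      -- • y`.
      set m := ∫ s in Ioo a b, ψ s with hm
      have hψi : IntegrableOn ψ (Ioo a b) := (hψ.continuous.integrable_of_hasCompactSupport hc).integrableOn
      have hβi : IntegrableOn β (Ioo a b) := (hβ.continuous.integrable_of_hasCompactSupport hβc).integrableOn
      have hts : tsupport (fun s => ψ s - m * β s) ⊆ Ioo a b := by
        refine (tsupport_sub ψ (fun s => m * β s)).trans (union_subset hs ?_)
        exact (tsupport_mul_subset_right (f := fun _ => m) (g := β)).trans hβs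
      obtain ⟨φ, h1, h2, h3, h4⟩ := exists_compactSupport_primitive
        (η := fun s => ψ s - m * β s) (hψ.sub (contDiff_const.mul hβ))
        (hc.sub hβc.mul_left) hts hab (by
          rw [integral_sub hψi (hβi.const_mul m), integral_const_mul, hβ1, mul_one, hm, sub_self])
      have h5 := h.2.2 φ h1 h2 h3
      rw [h4] at h5
      simp only [sub_smul, mul_smul, Pi.zero_apply, smul_zero, integral_zero, neg_zero] at h5
      rw [integral_sub (g := fun s => m • β s • y s) (hint ψ hψ.continuous hc hs)
        ((hint β hβ.continuous hβc hβs).smul m), integral_smul] at h5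
      rw [← setIntegral_eq_integral_of_forall_compl_eq_zero (s := Ioo a b) fun x hx => by
        rw [image_eq_zero_of_notMem_tsupport fun h' => hx (hs h'), zero_smul]]
      simp only [smul_sub]
      rw [integral_sub (hint ψ hψ.continuous hc hs) (hψi.smul_const _), integral_smul_const,
        ← hm, h5])
  filter_upwards [this] with s hs hsI
  exact sub_eq_zero.1 (hs hsI)

/-- The difference of `y` and a primitive of `v` has weak derivative zero, so it is constant almost
everywhere, and by continuity everywhere on the closed interval. The degenerate interval, which
occurs for `t = T`, is treated apart. -/
theorem HasWeakDeriv.isPrimitive [CompleteSpace E] (hab : a ≤ b) (hy : ContinuousOn y (Icc a b))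
    (h : HasWeakDeriv a b y v) (hv : IntegrableOn v (Ioo a b)) : IsPrimitive a b y v := by
  have hvi := (intervalIntegrable_iff_integrableOn_Ioo_of_le hab).2 hv
  rcases hab.eq_or_lt with rfl | hlt
  · refine ⟨hvi, fun r hr s hs => ?_⟩
    simp only [Icc_self, mem_singleton_iff] at hr hs
    simp [hr, hs]
  have hP := isPrimitive_integral hvi hab (0 : E)
  have hW := hP.hasWeakDeriv hab
  set V : ℝ → E := fun s => 0 + ∫ τ in a..s, v τ
  have hd : HasWeakDeriv a b (y - V) 0 := by
    refine ⟨h.1.sub hW.1, (locallyIntegrableOn_const (0 : E)), fun φ h1 h2 h3 => ?_⟩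
    have hφd : Continuous (deriv φ) := h1.continuous_deriv (by simp)
    have hint : ∀ w : ℝ → E, ContinuousOn w (Icc a b) →
        IntegrableOn (fun s => deriv φ s • w s) (Ioo a b) := fun w hw =>
      ((hφd.continuousOn.smul hw).integrableOn_Icc).mono_set Ioo_subset_Icc_self
    simp only [Pi.sub_apply, smul_sub, Pi.zero_apply, smul_zero, integral_zero, neg_zero]
    rw [integral_sub (hint y hy) (hint V (hP.continuousOn hab)), h.2.2 φ h1 h2 h3,
      hW.2.2 φ h1 h2 h3, sub_self]
  obtain ⟨c, hc⟩ := hd.ae_eq_const hlt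
  have hcont : ContinuousOn (y - V) (Icc a b) := hy.sub (hP.continuousOn hab)
  have heq : EqOn (y - V) (fun _ => c) (Icc a b) := by
    have h1 : EqOn (y - V) (fun _ => c) (Ioo a b) := by
      refine Measure.eqOn_open_of_ae_eq (μ := volume) ?_ isOpen_Ioo
        (hcont.mono Ioo_subset_Icc_self) continuousOn_const
      exact (ae_restrict_iff' measurableSet_Ioo).2 hc
    have h2 := h1.of_subset_closure hcont continuousOn_const Ioo_subset_Icc_self
      (by rw [closure_Ioo hlt.ne])
    exact h2
  refine ⟨hvi, fun r hr s hs => ?_⟩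
  rw [← hP.sub_eq r hr s hs]
  have h3 := (heq hr).trans (heq hs).symm
  simp only [Pi.sub_apply] at h3
  rw [sub_eq_sub_iff_sub_eq_sub] at h3
  rw [← neg_sub (y r), h3, neg_sub]

/-- A nonzero derivative forces `y ≠ c` at all nearby other times, so such points are isolated from
the right in the level set, and a subset of the line has only countably many points of this kind. -/
theorem countable_setOf_hasDerivAt_ne_zero (y : ℝ → E) (c : E) :
    {s | y s = c ∧ ∃ w ≠ 0, HasDerivAt y w s}.Countable := by
  refine (countable_setOfPred_isolated_right_within (s := {s | y s = c})).mono ?_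
  rintro s ⟨hs, w, hw, hd⟩
  refine ⟨hs, ?_⟩
  have h1 : ∀ᶠ z in 𝓝[≠] s, y z ≠ c := hd.eventually_ne hw
  have h2 : 𝓝[{s | y s = c} ∩ Ioi s] s ≤ 𝓝[≠] s :=
    nhdsWithin_mono _ fun z hz => ne_of_gt hz.2
  have h3 : ∀ᶠ z in 𝓝[{s | y s = c} ∩ Ioi s] s, False := by
    filter_upwards [h2 h1, self_mem_nhdsWithin] with z hz hz'
    exact hz hz'.1
  exact eventually_false_iff_eq_bot.1 h3

/-- Used with `c` a vertex: it is why the cost at a vertex need not involve the velocity. -/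
theorem ae_deriv_eq_zero_of_eq (y v : ℝ → E) (c : E) :
    ∀ᵐ s, HasDerivAt y (v s) s → y s = c → v s = 0 := by
  have := (countable_setOf_hasDerivAt_ne_zero y c).ae_notMem volume
  filter_upwards [this] with s hs hd hc
  by_contra hne
  exact hs ⟨hc, _, hne, hd⟩

end Paths

/-! ### Geometry of networks -/

namespace Network

variable {d n m : ℕ} {G : Network d n m}

theorem isClosed_dom (G : Network d n m) (i : Fin m) : IsClosed (G.dom i) :=
  (isClosed_le continuous_const continuous_id).inter
    (isClosed_le ENNReal.continuous_ofReal continuous_const)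

theorem continuous_coord (G : Network d n m) (i : Fin m) : Continuous (G.coord i) := by
  unfold coord; fun_prop

theorem continuous_param (G : Network d n m) (i : Fin m) : Continuous (G.param i) := by
  unfold param; fun_prop

theorem coord_mem_dom (hG : G.Valid) {i : Fin m} {z : EuclideanSpace ℝ (Fin d)}
    (hz : z ∈ G.edge i) : G.coord i z ∈ G.dom i := by
  obtain ⟨s, hs, rfl⟩ := hz
  rwa [G.coord_param hG]

theorem param_coord (hG : G.Valid) {i : Fin m} {z : EuclideanSpace ℝ (Fin d)}
    (hz : z ∈ G.edge i) : G.param i (G.coord i z) = z := by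
  obtain ⟨s, hs, rfl⟩ := hz
  rw [G.coord_param hG]

theorem isClosed_edge (hG : G.Valid) (i : Fin m) : IsClosed (G.edge i) := by
  have : G.edge i = G.coord i ⁻¹' G.dom i ∩ {z | G.param i (G.coord i z) = z} := by
    ext z
    exact ⟨fun hz => ⟨coord_mem_dom hG hz, param_coord hG hz⟩, fun hz => ⟨_, hz.1, hz.2⟩⟩
  rw [this]
  exact ((G.isClosed_dom i).preimage (G.continuous_coord i)).inter
    (isClosed_eq ((G.continuous_param i).comp (G.continuous_coord i)) continuous_id)

theorem isClosed_carrier (hG : G.Valid) : IsClosed G.carrier :=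
  isClosed_iUnion_of_finite fun i => isClosed_edge hG i

theorem mem_carrier {z : EuclideanSpace ℝ (Fin d)} : z ∈ G.carrier ↔ ∃ i, z ∈ G.edge i :=
  mem_iUnion

theorem mem_range_vertex (hG : G.Valid) {i k : Fin m} (hik : i ≠ k)
    {z : EuclideanSpace ℝ (Fin d)} (hi : z ∈ G.edge i) (hk : z ∈ G.edge k) :
    z ∈ range G.vertex := by
  rcases hG.inter_edge i k hik with h | ⟨j, h⟩
  · exact absurd (h ▸ (⟨hi, hk⟩ : z ∈ G.edge i ∩ G.edge k)) (notMem_empty z)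
  · have : z ∈ G.edge i ∩ G.edge k := ⟨hi, hk⟩
    rw [h] at this
    exact ⟨j, (mem_singleton_iff.1 this).symm⟩

theorem eq_of_mem_edge (hG : G.Valid) {i k : Fin m} {z : EuclideanSpace ℝ (Fin d)}
    (hi : z ∈ G.edge i) (hz : z ∉ range G.vertex) (hk : z ∈ G.edge k) : k = i := by
  by_contra h
  exact hz (mem_range_vertex hG h hk hi)

/-- The edges are finitely many and closed, so those that miss `z₀` also miss a neighbourhood of it.
Together with the analogous fact for vertices this is the local structure of the network. -/
theorem eventually_mem_edge_imp (hG : G.Valid) (z₀ : EuclideanSpace ℝ (Fin d)) :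
    ∀ᶠ z in 𝓝 z₀, ∀ i, z ∈ G.edge i → z₀ ∈ G.edge i := by
  refine eventually_all.2 fun i => ?_
  by_cases h : z₀ ∈ G.edge i
  · exact Eventually.of_forall fun _ _ => h
  · filter_upwards [(isClosed_edge hG i).isOpen_compl.mem_nhds h] with z hz hz'
    exact absurd hz' hz

theorem eventually_mem_range_vertex_imp (G : Network d n m) (z₀ : EuclideanSpace ℝ (Fin d)) :
    ∀ᶠ z in 𝓝 z₀, z ∈ range G.vertex → z = z₀ := by
  have : ∀ᶠ z in 𝓝 z₀, ∀ j, z = G.vertex j → z = z₀ := by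
    refine eventually_all.2 fun j => ?_
    by_cases h : z₀ = G.vertex j
    · exact Eventually.of_forall fun z hz => hz.trans h.symm
    · filter_upwards [isOpen_ne.mem_nhds h] with z hz hz'
      exact absurd hz' hz
  filter_upwards [this] with z hz
  rintro ⟨j, rfl⟩
  exact hz j rfl

theorem eventually_mem_edge (hG : G.Valid) {i : Fin m} {z₀ : EuclideanSpace ℝ (Fin d)}
    (hi : z₀ ∈ G.edge i) (hz : z₀ ∉ range G.vertex) :
    ∀ᶠ z in 𝓝 z₀, z ∈ G.carrier → z ∈ G.edge i := by
  filter_upwards [eventually_mem_edge_imp hG z₀] with z h hc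
  obtain ⟨k, hk⟩ := mem_carrier.1 hc
  rwa [eq_of_mem_edge hG hi hz (h k hk)] at hk

/-- Away from the vertices the path stays for a short time in one edge, where it equals `param` of
its own coordinate; both sides are then differentiated. -/
theorem velocity_eq_smul_dir (hG : G.Valid) {w : ℝ → EuclideanSpace ℝ (Fin d)}
    {w' : EuclideanSpace ℝ (Fin d)} {r : ℝ} {i : Fin m} (hd : HasDerivAt w w' r)
    (hmem : ∀ᶠ s in 𝓝 r, w s ∈ G.carrier) (hi : w r ∈ G.edge i) (hv : w r ∉ range G.vertex) :
    w' = (inner ℝ (G.dir i) w' : ℝ) • G.dir i := by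
  have h1 : w =ᶠ[𝓝 r] fun s => G.param i (G.coord i (w s)) := by
    filter_upwards [hmem, hd.continuousAt.eventually (eventually_mem_edge hG hi hv)] with s h2 h3
    exact (param_coord hG (h3 h2)).symm
  have h2 : HasDerivAt (fun s => G.param i (G.coord i (w s)))
      ((inner ℝ (G.dir i) w' : ℝ) • G.dir i) r := by
    have h3 : HasDerivAt (fun s => G.coord i (w s)) (inner ℝ (G.dir i) w') r := by
      have := (hasDerivAt_const r (G.dir i)).inner ℝ (hd.sub_const (G.vertex (G.src i)))
      simpa [coord] using! this
    exact (h3.smul_const (G.dir i)).const_add _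
  exact hd.unique (h2.congr_of_eventuallyEq h1)

theorem norm_velocity (hG : G.Valid) {w : ℝ → EuclideanSpace ℝ (Fin d)}
    {w' : EuclideanSpace ℝ (Fin d)} {r : ℝ} {i : Fin m} (hd : HasDerivAt w w' r)
    (hmem : ∀ᶠ s in 𝓝 r, w s ∈ G.carrier) (hi : w r ∈ G.edge i) (hv : w r ∉ range G.vertex) :
    ‖w'‖ = |(inner ℝ (G.dir i) w' : ℝ)| := by
  conv_lhs => rw [velocity_eq_smul_dir hG hd hmem hi hv]
  rw [norm_smul, hG.norm_dir i, mul_one, Real.norm_eq_abs]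

/-- The signed distance to `z₀` on the `i`-th edge, extended by zero to the other edges. -/
noncomputable def branch (G : Network d n m) (i : Fin m) (z₀ z : EuclideanSpace ℝ (Fin d)) : ℝ :=
  (G.edge i).indicator (fun z' => (inner ℝ (G.dir i) (z' - z₀) : ℝ)) z

theorem abs_inner_dir_le (hG : G.Valid) (i : Fin m) (z : EuclideanSpace ℝ (Fin d)) :
    |(inner ℝ (G.dir i) z : ℝ)| ≤ ‖z‖ := by
  simpa [hG.norm_dir i] using abs_real_inner_le_norm (G.dir i) z

theorem abs_branch_le (hG : G.Valid) (i : Fin m) (z₀ z : EuclideanSpace ℝ (Fin d)) :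
    |G.branch i z₀ z| ≤ ‖z - z₀‖ := by
  unfold branch
  by_cases h : z ∈ G.edge i
  · rw [indicator_of_mem h]
    exact abs_inner_dir_le hG i _
  · rw [indicator_of_notMem h]
    simp

theorem branch_self (hG : G.Valid) (i : Fin m) (z₀ : EuclideanSpace ℝ (Fin d)) :
    G.branch i z₀ z₀ = 0 := by
  simpa using abs_branch_le hG i z₀ z₀

/-- Away from the vertices, `branch` is locally an affine function on the network. -/
theorem eventually_branch_eq (hG : G.Valid) (i : Fin m) (z₀ : EuclideanSpace ℝ (Fin d))
    {z : EuclideanSpace ℝ (Fin d)} (hz : z ∈ G.carrier) (hv : z ∉ range G.vertex) :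
    ∀ᶠ z' in 𝓝 z, z' ∈ G.carrier → G.branch i z₀ z' =
      (G.edge i).indicator (fun _ => (inner ℝ (G.dir i) (z' - z₀) : ℝ)) z := by
  obtain ⟨k, hk⟩ := mem_carrier.1 hz
  by_cases h : z ∈ G.edge i
  · filter_upwards [eventually_mem_edge hG h hv] with z' h1 h2
    rw [branch, indicator_of_mem (h1 h2), indicator_of_mem h]
  · filter_upwards [eventually_mem_edge_imp hG z] with z' h1 h2
    rw [branch, indicator_of_notMem (fun h3 => h (h1 i h3)), indicator_of_notMem h]

/-- Away from the vertices `branch` is locally affine or zero. At the vertex `z₀` it is not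
differentiable along the network, but it is bounded by the distance to `z₀`, so a path with zero
velocity there still gives derivative zero. -/
theorem hasDerivAt_branch (hG : G.Valid) (i : Fin m) {z₀ : EuclideanSpace ℝ (Fin d)}
    {w : ℝ → EuclideanSpace ℝ (Fin d)} {w' : EuclideanSpace ℝ (Fin d)} {r : ℝ}
    (hd : HasDerivAt w w' r) (hmem : ∀ᶠ s in 𝓝 r, w s ∈ G.carrier)
    (hz : w r ∈ range G.vertex → w r = z₀ ∧ w' = 0) :
    HasDerivAt (fun s => G.branch i z₀ (w s))
      ((G.edge i).indicator (fun _ => (inner ℝ (G.dir i) w' : ℝ)) (w r)) r := by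
  by_cases hv : w r ∈ range G.vertex
  · obtain ⟨h1, rfl⟩ := hz hv
    have h0 : (G.edge i).indicator (fun _ => (inner ℝ (G.dir i)
        (0 : EuclideanSpace ℝ (Fin d)) : ℝ)) (w r) = 0 := by simp
    rw [h0]
    rw [hasDerivAt_iff_isLittleO] at hd ⊢
    refine Asymptotics.IsBigO.trans_isLittleO (Asymptotics.IsBigO.of_bound 1 ?_) hd
    refine Eventually.of_forall fun s => ?_
    rw [h1, branch_self hG]
    simpa using abs_branch_le hG i z₀ (w s)
  · have h1 := hd.continuousAt.eventually (eventually_branch_eq hG i z₀ hmem.self_of_nhds hv)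
    have h2 : (fun s => G.branch i z₀ (w s)) =ᶠ[𝓝 r] fun s =>
        (G.edge i).indicator (fun _ => (inner ℝ (G.dir i) (w s - z₀) : ℝ)) (w r) := by
      filter_upwards [h1, hmem] with s h3 h4 using h3 h4
    refine HasDerivAt.congr_of_eventuallyEq ?_ h2
    by_cases h : w r ∈ G.edge i
    · simp only [indicator_of_mem h]
      have := (hasDerivAt_const r (G.dir i)).inner ℝ (hd.sub_const z₀)
      simpa using! this
    · simp only [indicator_of_notMem h]
      exact hasDerivAt_const r 0

theorem continuousWithinAt_branch (hG : G.Valid) (i : Fin m) {z₀ z : EuclideanSpace ℝ (Fin d)}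
    (hz : z ∈ G.carrier) (hv : z ∈ range G.vertex → z = z₀) :
    ContinuousWithinAt (G.branch i z₀) G.carrier z := by
  by_cases h : z ∈ range G.vertex
  · obtain rfl := hv h
    refine ContinuousAt.continuousWithinAt ?_
    rw [ContinuousAt, branch_self hG, tendsto_zero_iff_abs_tendsto_zero]
    refine squeeze_zero (fun _ => abs_nonneg _) (fun z' => abs_branch_le hG i z z') ?_
    have : Continuous fun z' => ‖z' - z‖ := by fun_prop
    simpa using this.tendsto z
  · have h1 : ∀ᶠ z' in 𝓝[G.carrier] z, G.branch i z₀ z' =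
        (G.edge i).indicator (fun _ => (inner ℝ (G.dir i) (z' - z₀) : ℝ)) z := by
      filter_upwards [nhdsWithin_le_nhds (eventually_branch_eq hG i z₀ hz h),
        self_mem_nhdsWithin] with z' h2 h3 using h2 h3
    refine ContinuousWithinAt.congr_of_eventuallyEq ?_ h1 (h1.self_of_nhdsWithin hz)
    refine Continuous.continuousWithinAt ?_
    by_cases h2 : z ∈ G.edge i
    · simp only [indicator_of_mem h2]; fun_prop
    · simp only [indicator_of_notMem h2]; fun_prop

/-- A path that leaves an edge passes through a vertex. -/
theorem exists_mem_range_vertex (hG : G.Valid) {i : Fin m} {a b : ℝ}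
    {w : ℝ → EuclideanSpace ℝ (Fin d)} (hw : ContinuousOn w (Icc a b))
    (hmem : MapsTo w (Icc a b) G.carrier) {r s : ℝ} (hr : r ∈ Icc a b) (hs : s ∈ Icc a b)
    (hri : w r ∈ G.edge i) (hsi : w s ∉ G.edge i) :
    ∃ q ∈ Icc a b, w q ∈ range G.vertex := by
  have hpre : IsPreconnected (w '' Icc a b) := isPreconnected_Icc.image w hw
  have hcl : IsClosed (⋃ k : {k // k ≠ i}, G.edge k.1) :=
    isClosed_iUnion_of_finite fun k => isClosed_edge hG k.1
  -- The connected image is covered by two closed sets, the edge and the union of the other edges.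
  -- It meets both, hence their intersection, which consists of vertices.
  obtain ⟨_, ⟨q, hq, rfl⟩, h1, h2⟩ := isPreconnected_closed_iff.1 hpre (G.edge i)
    (⋃ k : {k // k ≠ i}, G.edge k.1) (isClosed_edge hG i) hcl (by
      rintro _ ⟨q, hq, rfl⟩
      obtain ⟨k, hk⟩ := mem_carrier.1 (hmem hq)
      by_cases h : k = i
      · exact Or.inl (h ▸ hk)
      · exact Or.inr (mem_iUnion.2 ⟨⟨k, h⟩, hk⟩)) ⟨_, mem_image_of_mem w hr, hri⟩ (by
      obtain ⟨k, hk⟩ := mem_carrier.1 (hmem hs)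
      exact ⟨_, mem_image_of_mem w hs, mem_iUnion.2 ⟨⟨k, fun h => hsi (h ▸ hk)⟩, hk⟩⟩)
  obtain ⟨k, hk⟩ := mem_iUnion.1 h2
  exact ⟨q, hq, mem_range_vertex hG k.2.symm h1 hk⟩

/-- If exactly one endpoint lies on the edge, the path passes through a vertex, which must be `z₀`;
the value of `branch` at that endpoint is then at most the length of a piece of the path. Without
`hloc` this fails, since `branch` may jump at the other vertices. -/
theorem dist_branch_le (hG : G.Valid) (i : Fin m) {z₀ : EuclideanSpace ℝ (Fin d)} {r s : ℝ}
    {w v : ℝ → EuclideanSpace ℝ (Fin d)} (hrs : r ≤ s) (h : IsPrimitive r s w v)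
    (hmem : MapsTo w (Icc r s) G.carrier)
    (hloc : ∀ q ∈ Icc r s, w q ∈ range G.vertex → w q = z₀) :
    dist (G.branch i z₀ (w r)) (G.branch i z₀ (w s)) ≤ ∫ τ in r..s, ‖v τ‖ := by
  have hr : r ∈ Icc r s := ⟨le_rfl, hrs⟩
  have hs : s ∈ Icc r s := ⟨hrs, le_rfl⟩
  have hcont := h.continuousOn hrs
  have hmono : ∀ q ∈ Icc r s, ∀ q' ∈ Icc r s, q ≤ q' → ‖w q' - w q‖ ≤ ∫ τ in r..s, ‖v τ‖ := by
    intro q hq q' hq' hqq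
    refine (h.norm_sub_le hq hq' hqq).trans ?_
    refine intervalIntegral.integral_mono_interval hq.1 hqq hq'.2 ?_ h.intervalIntegrable.norm
    exact Eventually.of_forall fun τ => norm_nonneg _
  rw [Real.dist_eq]
  by_cases hri : w r ∈ G.edge i <;> by_cases hsi : w s ∈ G.edge i
  · rw [branch, branch, indicator_of_mem hri, indicator_of_mem hsi, ← inner_sub_right,
      sub_sub_sub_cancel_right]
    refine (abs_inner_dir_le hG i _).trans ?_
    rw [norm_sub_rev]
    exact hmono r hr s hs hrs
  · obtain ⟨q, hq, hqv⟩ := exists_mem_range_vertex hG hcont hmem hr hs hri hsi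
    rw [branch, branch, indicator_of_notMem hsi, sub_zero]
    refine (abs_branch_le hG i z₀ (w r)).trans ?_
    rw [← hloc q hq hqv, norm_sub_rev]
    exact hmono r hr q hq hq.1
  · obtain ⟨q, hq, hqv⟩ := exists_mem_range_vertex hG hcont hmem hs hr hsi hri
    rw [branch, branch, indicator_of_notMem hri, zero_sub, abs_neg]
    refine (abs_branch_le hG i z₀ (w s)).trans ?_
    rw [← hloc q hq hqv]
    exact hmono q hq s hs hq.2
  · rw [branch, branch, indicator_of_notMem hri, indicator_of_notMem hsi, sub_self, abs_zero]
    exact (norm_nonneg _).trans (hmono r hr s hs hrs)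

/-- This turns an integral of a lower bound linear in the velocity, edge by edge, into a difference
of endpoint values. -/
theorem isPrimitive_branch (hG : G.Valid) (i : Fin m) {z₀ : EuclideanSpace ℝ (Fin d)} {a b : ℝ}
    {w v : ℝ → EuclideanSpace ℝ (Fin d)} (hab : a ≤ b) (h : IsPrimitive a b w v)
    (hmem : MapsTo w (Icc a b) G.carrier)
    (hloc : ∀ q ∈ Icc a b, w q ∈ range G.vertex → w q = z₀) :
    IsPrimitive a b (fun s => G.branch i z₀ (w s))
      (fun s => (G.edge i).indicator (fun _ => (inner ℝ (G.dir i) (v s) : ℝ)) (w s)) := by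
  have hac : AbsolutelyContinuousOnInterval (fun s => G.branch i z₀ (w s)) a b := by
    refine h.absolutelyContinuous_of_le hab fun r hr s hs hrs => ?_
    have hsub : Icc r s ⊆ Icc a b := Icc_subset_Icc hr.1 hs.2
    exact dist_branch_le hG i hrs (h.mono hrs hsub) (hmem.mono_left hsub)
      fun q hq => hloc q (hsub hq)
  have hder : ∀ᵐ s, s ∈ Ioo a b → HasDerivAt (fun s => G.branch i z₀ (w s))
      ((G.edge i).indicator (fun _ => (inner ℝ (G.dir i) (v s) : ℝ)) (w s)) s := by
    filter_upwards [h.ae_hasDerivAt hab, ae_deriv_eq_zero_of_eq w v z₀] with s h1 h2 hs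
    refine hasDerivAt_branch hG i (h1 hs) ?_ fun hv => ?_
    · filter_upwards [Icc_mem_nhds hs.1 hs.2] with q hq using hmem hq
    · have := hloc s (Ioo_subset_Icc_self hs) hv
      exact ⟨this, h2 (h1 hs) this⟩
  refine isPrimitive_of_absolutelyContinuous hac hab ?_ hder
  refine hac.intervalIntegrable_deriv.congr_ae ?_
  rw [uIoc_of_le hab, ← restrict_Ioo_eq_restrict_Ioc]
  refine (ae_restrict_iff' measurableSet_Ioo).2 ?_
  filter_upwards [hder] with s hs hsI using (hs hsI).deriv

end Network

/-! ### Values of the costs -/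

namespace NetworkCosts

variable {d n m : ℕ} {c : NetworkCosts n m} {G : Network d n m}

theorem runningCost_of_mem_edge (hG : G.Valid) {i : Fin m} {z : EuclideanSpace ℝ (Fin d)}
    (hi : z ∈ G.edge i) (hv : z ∉ range G.vertex) (a : EuclideanSpace ℝ (Fin d)) (τ : ℝ) :
    c.runningCost G z a τ = c.ℓ i (G.coord i z) (inner ℝ (G.dir i) a) τ := by
  rw [runningCost, Finset.sum_eq_single i, indicator_of_mem (show z ∈ G.edge i \ range G.vertex from ⟨hi, hv⟩),
    Finset.sum_eq_zero, add_zero]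
  · exact fun j _ => indicator_of_notMem (fun h => hv ⟨j, (mem_singleton_iff.1 h).symm⟩) _
  · exact fun k _ hk => indicator_of_notMem
      (fun h => hk (Network.eq_of_mem_edge hG hi hv h.1)) _
  · simp

theorem runningCost_vertex (hG : G.Valid) (j : Fin n) (a : EuclideanSpace ℝ (Fin d)) (τ : ℝ) :
    c.runningCost G (G.vertex j) a τ = c.vertexCost G j τ := by
  rw [runningCost, Finset.sum_eq_zero, zero_add, Finset.sum_eq_single j,
    indicator_of_mem (mem_singleton _)]
  · exact fun k _ hk => indicator_of_notMem
      (fun h => hk (hG.vertex_injective (mem_singleton_iff.1 h)).symm) _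
  · simp
  · exact fun k _ => indicator_of_notMem (fun h => h.2 (mem_range_self j)) _

theorem terminalCost_of_mem_edge (hG : G.Valid) {i : Fin m} {z : EuclideanSpace ℝ (Fin d)}
    (hi : z ∈ G.edge i) (hv : z ∉ range G.vertex) :
    c.terminalCost G z = c.g i (G.coord i z) := by
  rw [terminalCost, Finset.sum_eq_single i, indicator_of_mem (show z ∈ G.edge i \ range G.vertex from ⟨hi, hv⟩),
    Finset.sum_eq_zero, add_zero]
  · exact fun j _ => indicator_of_notMem (fun h => hv ⟨j, (mem_singleton_iff.1 h).symm⟩) _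
  · exact fun k _ hk => indicator_of_notMem
      (fun h => hk (Network.eq_of_mem_edge hG hi hv h.1)) _
  · simp

theorem terminalCost_vertex (hG : G.Valid) (j : Fin n) :
    c.terminalCost G (G.vertex j) = min (c.gstar j)
      (⨅ i : {i : Fin m // G.vertex j ∈ G.edge i}, c.g i.1 (G.coord i.1 (G.vertex j))) := by
  rw [terminalCost, Finset.sum_eq_zero, zero_add, Finset.sum_eq_single j,
    indicator_of_mem (mem_singleton _)]
  · exact fun k _ hk => indicator_of_notMem
      (fun h => hk (hG.vertex_injective (mem_singleton_iff.1 h)).symm) _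
  · simp
  · exact fun k _ => indicator_of_notMem (fun h => h.2 (mem_range_self j)) _

end NetworkCosts

/-! ### The running cost of an edge -/

/-- Superlinear growth, the only use of which is to beat affine functions for large velocities. -/
theorem exists_abs_gt_imp_le_rpow {p C : ℝ} (hp : 1 < p) (hC : 0 < C) (q e : ℝ) :
    ∃ A : ℝ, 0 ≤ A ∧ ∀ a : ℝ, A < |a| → q * a + e ≤ C * |a| ^ p := by
  have h1 : Tendsto (fun x : ℝ => C * x ^ (p - 1)) atTop atTop :=
    (tendsto_rpow_atTop (by linarith)).const_mul_atTop hC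
  obtain ⟨A, hA⟩ := eventually_atTop.1 (h1.eventually_ge_atTop (|q| + |e|))
  refine ⟨max A 1, le_trans zero_le_one (le_max_right _ _), fun a ha => ?_⟩
  have h2 := hA |a| ((le_max_left _ _).trans ha.le)
  have h3 : 1 < |a| := (le_max_right _ _).trans_lt ha
  have h4 : C * |a| ^ p = |a| * (C * |a| ^ (p - 1)) := by
    rw [Real.rpow_sub_one (by positivity)]
    field_simp
  have h5 : q * a ≤ |q| * |a| := by rw [← abs_mul]; exact le_abs_self _
  have h6 : e ≤ |e| * |a| := (le_abs_self e).trans (le_mul_of_one_le_right (abs_nonneg e) h3.le)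
  rw [h4]
  nlinarith [abs_nonneg a]

namespace EdgeCostAssumptions

variable {p T C₀ c₀ : ℝ} {I : Set ℝ} {ℓ : ℝ → ℝ → ℝ → ℝ}

theorem differentiable_velocity (h : EdgeCostAssumptions p T C₀ c₀ I ℓ) {y s : ℝ} (hy : y ∈ I)
    (hs : s ∈ Icc 0 T) : Differentiable ℝ (fun a => ℓ y a s) := by
  rw [← differentiableOn_univ]
  exact (h.differentiableOn s hs).comp (f := fun a : ℝ => (y, a)) (by fun_prop)
    fun a _ => ⟨hy, mem_univ a⟩

theorem tangent_le (h : EdgeCostAssumptions p T C₀ c₀ I ℓ) {y s : ℝ} (hy : y ∈ I)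
    (hs : s ∈ Icc 0 T) (a₀ a : ℝ) :
    ℓ y a₀ s + deriv (fun a => ℓ y a s) a₀ * (a - a₀) ≤ ℓ y a s := by
  have hconv := (h.h4 y hy s hs).convexOn
  have hd := h.differentiable_velocity hy hs
  rcases lt_trichotomy a₀ a with hlt | rfl | hlt
  · have := hconv.deriv_le_slope (mem_univ a₀) (mem_univ a) hlt (hd a₀)
    rw [slope_def_field, le_div_iff₀ (sub_pos.2 hlt)] at this
    linarith
  · simp
  · have := hconv.slope_le_deriv (mem_univ a) (mem_univ a₀) hlt (hd a₀)
    rw [slope_def_field, div_le_iff₀ (sub_pos.2 hlt)] at this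
    linarith

/-- The tangent at `a`, evaluated at velocity `0`, gives `ℓ y a s ≤ ℓ y 0 s + ∂ₐℓ · a`. The first
term is bounded by compactness, the second by the growth of `∂ₐℓ` in [H3]; the lower bound is [H1].
-/
theorem exists_abs_le (h : EdgeCostAssumptions p T C₀ c₀ I ℓ) (hp : 1 < p) (hC : 0 < C₀)
    (hI : IsClosed I) (hI0 : I ⊆ Ici 0) {r : ℝ} (hr : 0 < r) :
    ∃ C : ℝ, 0 ≤ C ∧ ∀ y ∈ I, y ≤ r → ∀ a, ∀ s ∈ Icc 0 T, |ℓ y a s| ≤ C * (1 + |a| ^ p) := by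
  obtain ⟨k, hk0, hk⟩ := h.h3 r hr
  have hcomp : IsCompact ((I ∩ Icc 0 r) ×ˢ ({0} : Set ℝ) ×ˢ Icc 0 T) :=
    (isCompact_Icc.inter_left hI).prod (isCompact_singleton.prod isCompact_Icc)
  obtain ⟨B, hB⟩ := hcomp.exists_bound_of_continuousOn (h.continuousOn.mono (by
    exact prod_mono inter_subset_left (prod_mono (subset_univ _) subset_rfl)))
  refine ⟨|B| + 2 * k + |c₀|, by positivity, fun y hy hyr a s hs => ?_⟩
  have h0 : ℓ y 0 s ≤ |B| := (le_abs_self _).trans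
    ((hB (y, 0, s) ⟨⟨hy, hI0 hy, hyr⟩, rfl, hs⟩).trans (le_abs_self B))
  have ht := h.tangent_le hy hs a 0
  have hd := (hk y hy hyr a s hs).2
  have hx : 0 ≤ |a| ^ p := by positivity
  have hlow := h.h1 y hy a s hs
  have hprod : |deriv (fun a' => ℓ y a' s) a * a| ≤ 2 * k * (1 + |a| ^ p) := by
    rw [abs_mul]
    have h1 : |a| ^ (p - 1) * |a| ≤ |a| ^ p := by
      rcases eq_or_ne a 0 with rfl | hne
      · simp only [abs_zero, mul_zero]; positivity
      · rw [← Real.rpow_add_one (abs_ne_zero.2 hne), sub_add_cancel]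
    have h2 : |a| ≤ 1 + |a| ^ p := by
      rcases le_total |a| 1 with h3 | h3
      · linarith
      · have := Real.self_le_rpow_of_one_le h3 hp.le
        linarith
    nlinarith [mul_le_mul_of_nonneg_right hd (abs_nonneg a)]
  have hle := (abs_le.1 hprod).2
  rw [abs_le]
  constructor
  · have : -|c₀| ≤ c₀ := neg_abs_le c₀
    nlinarith [abs_nonneg c₀, abs_nonneg B, mul_nonneg hC.le hx,
      mul_nonneg (abs_nonneg B) hx, mul_nonneg hk0 hx, mul_nonneg (abs_nonneg c₀) hx]
  · nlinarith [abs_nonneg c₀, abs_nonneg B, mul_nonneg (abs_nonneg B) hx,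
      mul_nonneg (abs_nonneg c₀) hx]

/-- The point is uniformity over all velocities `a`, which is not compact: large velocities are
handled by coercivity, bounded ones by the tangent at the perturbed point, whose value and slope
vary continuously. -/
theorem eventually_tangent_le (h : EdgeCostAssumptions p T C₀ c₀ I ℓ) (hp : 1 < p) (hC : 0 < C₀)
    {y₀ s₀ : ℝ} (hy₀ : y₀ ∈ I) (hs₀ : s₀ ∈ Icc 0 T) (a₀ : ℝ) {ε : ℝ} (hε : 0 < ε) :
    ∀ᶠ u in 𝓝[I ×ˢ Icc 0 T] (y₀, s₀), ∀ a : ℝ,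
      ℓ y₀ a₀ s₀ + deriv (fun a => ℓ y₀ a s₀) a₀ * (a - a₀) - ε ≤ ℓ u.1 a u.2 := by
  set q := deriv (fun a => ℓ y₀ a s₀) a₀ with hq
  -- For `|a| > A` the tangent line at the base point lies below `C₀ * |a| ^ p + c₀`.
  obtain ⟨A, hA0, hA⟩ := exists_abs_gt_imp_le_rpow hp hC q (ℓ y₀ a₀ s₀ - q * a₀ - c₀)
  have hmaps : MapsTo (fun u : ℝ × ℝ => (u.1, a₀, u.2)) (I ×ˢ Icc 0 T)
      (I ×ˢ univ ×ˢ Icc 0 T) := fun u hu => ⟨hu.1, mem_univ _, hu.2⟩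
  have hcm : Continuous (fun u : ℝ × ℝ => (u.1, a₀, u.2)) := by fun_prop
  have hu₀ : (y₀, s₀) ∈ I ×ˢ Icc 0 T := ⟨hy₀, hs₀⟩
  have h1 := (h.continuousOn.comp hcm.continuousOn hmaps) (y₀, s₀) hu₀
  have h2 := (h.continuousOn_da.comp hcm.continuousOn hmaps) (y₀, s₀) hu₀
  -- Half of `ε` is spent on the change of the value, half on the change of the slope times `|a -
  -- a₀| ≤ A + |a₀| + 1`.
  have e1 := h1.eventually (eventually_gt_nhds (show ℓ y₀ a₀ s₀ - ε / 2 < _ by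
    simp only [Function.comp]; linarith))
  have e2 := Metric.tendsto_nhds.1 h2 (ε / (2 * (A + |a₀| + 1))) (by positivity)
  filter_upwards [e1, e2, self_mem_nhdsWithin] with u h3 h4 hu a
  simp only [Function.comp] at h3 h4
  rw [Real.dist_eq] at h4
  rcases lt_or_ge A |a| with ha | ha
  · have := hA a ha
    have := h.h1 u.1 hu.1 a u.2 hu.2
    linarith
  · have h5 := h.tangent_le hu.1 hu.2 a₀ a
    have h6 : |a - a₀| ≤ A + |a₀| + 1 := by
      have := abs_sub a a₀
      linarith
    have h7 : |(deriv (fun a => ℓ u.1 a u.2) a₀ - q) * (a - a₀)| ≤ ε / 2 := by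
      rw [abs_mul]
      calc _ ≤ ε / (2 * (A + |a₀| + 1)) * (A + |a₀| + 1) :=
            mul_le_mul h4.le h6 (abs_nonneg _) (by positivity)
        _ = ε / 2 := by field_simp
    have h8 := (abs_le.1 h7).1
    linarith

end EdgeCostAssumptions

/-! ### The costs on a network -/

/-- The assumptions on the costs of a network, with fixed constants `C₀` and `c₀`. -/
structure CostBounds {d n m : ℕ} (c : NetworkCosts n m) (G : Network d n m)
    (p T C₀ c₀ : ℝ) : Prop where
  pos : 0 < C₀
  edge : ∀ i, EdgeCostAssumptions p T C₀ c₀ (G.dom i) (c.ℓ i)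
  le_star : ∀ j, ∀ s ∈ Icc 0 T, c₀ ≤ c.ℓstar j s
  star : ∀ j, ContinuousOn (c.ℓstar j) (Icc 0 T)
  terminal : ∀ i, IsCb (G.dom i) (c.g i)

theorem NetworkCosts.Assumptions.exists_costBounds {d n m : ℕ} {c : NetworkCosts n m}
    {G : Network d n m} {p T : ℝ} (h : c.Assumptions G p T) :
    ∃ C₀ c₀, CostBounds c G p T C₀ c₀ := by
  obtain ⟨C₀, c₀, h1, h2, h3⟩ := h.edge
  exact ⟨C₀, c₀, h1, h2, h3, h.star, h.terminal⟩

namespace Network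

variable {d n m : ℕ} {G : Network d n m}

/-- The velocities that a trajectory in the network can have at `z`. -/
def IsVelocity (G : Network d n m) (z a : EuclideanSpace ℝ (Fin d)) : Prop :=
  (z ∈ range G.vertex → a = 0) ∧
    ∀ i, z ∈ G.edge i → z ∉ range G.vertex → ‖a‖ = |(inner ℝ (G.dir i) a : ℝ)|

theorem ae_isVelocity (hG : G.Valid) {a b : ℝ} {w v : ℝ → EuclideanSpace ℝ (Fin d)}
    (hd : ∀ᵐ s, s ∈ Ioo a b → HasDerivAt w (v s) s) (hmem : MapsTo w (Icc a b) G.carrier) :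
    ∀ᵐ s, s ∈ Ioo a b → G.IsVelocity (w s) (v s) := by
  have h1 : ∀ᵐ s, ∀ j, HasDerivAt w (v s) s → w s = G.vertex j → v s = 0 :=
    ae_all_iff.2 fun j => ae_deriv_eq_zero_of_eq w v (G.vertex j)
  filter_upwards [hd, h1] with s h2 h3 hs
  refine ⟨?_, fun i hi hv => norm_velocity hG (h2 hs) ?_ hi hv⟩
  · rintro ⟨j, hj⟩
    exact h3 j (h2 hs) hj.symm
  · filter_upwards [Icc_mem_nhds hs.1 hs.2] with q hq using hmem hq

theorem nonempty_edges_of_vertex (hG : G.Valid) (j : Fin n) :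
    Nonempty {i : Fin m // G.vertex j ∈ G.edge i} := by
  obtain ⟨i, hi⟩ := mem_carrier.1 (hG.vertex_mem j)
  exact ⟨⟨i, hi⟩⟩

theorem dom_subset_Ici (G : Network d n m) (i : Fin m) : G.dom i ⊆ Ici 0 := fun _ h => h.1

theorem coord_le (hG : G.Valid) (i : Fin m) (z : EuclideanSpace ℝ (Fin d)) :
    G.coord i z ≤ ‖z‖ + ‖G.vertex (G.src i)‖ :=
  (le_abs_self _).trans ((abs_inner_dir_le hG i _).trans (norm_sub_le _ _))

end Network

namespace CostBounds

variable {d n m : ℕ} {c : NetworkCosts n m} {G : Network d n m} {p T C₀ c₀ : ℝ}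

theorem vertexCost_le (j : Fin n) {i : Fin m} (hi : G.vertex j ∈ G.edge i) (τ : ℝ) :
    c.vertexCost G j τ ≤ c.ℓ i (G.coord i (G.vertex j)) 0 τ :=
  (min_le_right _ _).trans (ciInf_le (f := fun i : {i : Fin m // G.vertex j ∈ G.edge i} =>
    c.ℓ i.1 (G.coord i.1 (G.vertex j)) 0 τ) (finite_range _).bddBelow ⟨i, hi⟩)

theorem le_vertexCost (h : CostBounds c G p T C₀ c₀) (hG : G.Valid) (hp : 1 < p) (j : Fin n)
    {τ : ℝ} (hτ : τ ∈ Icc 0 T) : c₀ ≤ c.vertexCost G j τ := by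
  have := Network.nonempty_edges_of_vertex hG j
  refine le_min (h.le_star j τ hτ) (le_ciInf fun i => ?_)
  have := (h.edge i.1).h1 _ (Network.coord_mem_dom hG i.2) 0 τ hτ
  rwa [abs_zero, Real.zero_rpow (by linarith), mul_zero, zero_add] at this

theorem continuousOn_vertexCost (h : CostBounds c G p T C₀ c₀) (hG : G.Valid) (j : Fin n) :
    ContinuousOn (c.vertexCost G j) (Icc 0 T) := by
  classical
  have := Network.nonempty_edges_of_vertex hG j
  refine ContinuousOn.inf (h.star j) ?_
  have h1 : (fun τ => ⨅ i : {i : Fin m // G.vertex j ∈ G.edge i},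
      c.ℓ i.1 (G.coord i.1 (G.vertex j)) 0 τ) = fun τ => Finset.univ.inf' Finset.univ_nonempty
        (fun i : {i : Fin m // G.vertex j ∈ G.edge i} =>
          c.ℓ i.1 (G.coord i.1 (G.vertex j)) 0 τ) := by
    funext τ
    rw [Finset.inf'_univ_eq_ciInf]
  rw [h1]
  refine ContinuousOn.finset_inf'_apply _ fun i _ => ?_
  exact (h.edge i.1).continuousOn.comp (f := fun τ : ℝ => (G.coord i.1 (G.vertex j), (0 : ℝ), τ))
    (by fun_prop) fun τ hτ => ⟨Network.coord_mem_dom hG i.2, mem_univ _, hτ⟩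

theorem le_runningCost (h : CostBounds c G p T C₀ c₀) (hG : G.Valid) (hp : 1 < p)
    {z a : EuclideanSpace ℝ (Fin d)} (hz : z ∈ G.carrier) (ha : G.IsVelocity z a) {τ : ℝ}
    (hτ : τ ∈ Icc 0 T) : C₀ * ‖a‖ ^ p + c₀ ≤ c.runningCost G z a τ := by
  by_cases hv : z ∈ range G.vertex
  · obtain rfl := ha.1 hv
    obtain ⟨j, rfl⟩ := hv
    rw [NetworkCosts.runningCost_vertex hG, norm_zero, Real.zero_rpow (by linarith), mul_zero,
      zero_add]
    exact h.le_vertexCost hG hp j hτ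
  · obtain ⟨i, hi⟩ := Network.mem_carrier.1 hz
    rw [NetworkCosts.runningCost_of_mem_edge hG hi hv, ha.2 i hi hv]
    exact (h.edge i).h1 _ (Network.coord_mem_dom hG hi) _ τ hτ

theorem exists_abs_runningCost_le (h : CostBounds c G p T C₀ c₀) (hG : G.Valid) (hp : 1 < p)
    {R : ℝ} (hR : 0 ≤ R) : ∃ C : ℝ, 0 ≤ C ∧ ∀ z ∈ G.carrier, ‖z‖ ≤ R →
      ∀ a, ∀ s ∈ Icc 0 T, |c.runningCost G z a s| ≤ C * (1 + ‖a‖ ^ p) := by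
  have h1 : ∀ i, ∃ C : ℝ, 0 ≤ C ∧ ∀ y ∈ G.dom i, y ≤ R + ‖G.vertex (G.src i)‖ + 1 → ∀ a,
      ∀ s ∈ Icc 0 T, |c.ℓ i y a s| ≤ C * (1 + |a| ^ p) := fun i =>
    (h.edge i).exists_abs_le hp h.pos (G.isClosed_dom i) (G.dom_subset_Ici i) (by positivity)
  choose C hC0 hC using h1
  have h2 : ∀ j, ∃ B : ℝ, ∀ s ∈ Icc 0 T, ‖c.vertexCost G j s‖ ≤ B := fun j =>
    isCompact_Icc.exists_bound_of_continuousOn (h.continuousOn_vertexCost hG j)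
  choose B hB using h2
  refine ⟨∑ i, C i + ∑ j, |B j|, add_nonneg (Finset.sum_nonneg fun i _ => hC0 i)
    (Finset.sum_nonneg fun j _ => abs_nonneg _), fun z hz hzR a s hs => ?_⟩
  have hx : 0 ≤ ‖a‖ ^ p := by positivity
  by_cases hv : z ∈ range G.vertex
  · obtain ⟨j, rfl⟩ := hv
    rw [NetworkCosts.runningCost_vertex hG]
    have h3 := (hB j s hs).trans (le_abs_self _)
    have h4 := Finset.single_le_sum (f := fun j => |B j|) (fun j _ => abs_nonneg _)
      (Finset.mem_univ j)
    have h5 : 0 ≤ ∑ i, C i := Finset.sum_nonneg fun i _ => hC0 i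
    rw [Real.norm_eq_abs] at h3
    nlinarith [abs_nonneg (B j)]
  · obtain ⟨i, hi⟩ := Network.mem_carrier.1 hz
    rw [NetworkCosts.runningCost_of_mem_edge hG hi hv]
    have h3 := hC i _ (Network.coord_mem_dom hG hi)
      (by linarith [Network.coord_le hG i z]) (inner ℝ (G.dir i) a) s hs
    have h4 : |(inner ℝ (G.dir i) a : ℝ)| ^ p ≤ ‖a‖ ^ p :=
      Real.rpow_le_rpow (abs_nonneg _) (Network.abs_inner_dir_le hG i a) (by linarith)
    have h5 := Finset.single_le_sum (f := C) (fun i _ => hC0 i) (Finset.mem_univ i)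
    have h6 : 0 ≤ ∑ j, |B j| := Finset.sum_nonneg fun j _ => abs_nonneg _
    refine h3.trans ?_
    calc C i * (1 + |(inner ℝ (G.dir i) a : ℝ)| ^ p) ≤ C i * (1 + ‖a‖ ^ p) := by
          have := hC0 i
          gcongr
      _ ≤ _ := by gcongr; linarith

/-- Near `(z₀, a₀, s₀)` the running cost is bounded below by an affine function of the velocity
on each edge. -/
theorem exists_eventually_le_runningCost (h : CostBounds c G p T C₀ c₀) (hG : G.Valid)
    (hp : 1 < p) {z₀ a₀ : EuclideanSpace ℝ (Fin d)} (hz₀ : z₀ ∈ G.carrier)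
    (ha₀ : z₀ ∈ range G.vertex → a₀ = 0) {s₀ : ℝ} (hs₀ : s₀ ∈ Icc 0 T) :
    ∃ q : Fin m → ℝ, ∀ ε > 0, ∀ᶠ u in 𝓝 (z₀, s₀), u.1 ∈ G.carrier → u.2 ∈ Icc 0 T →
      ∀ a, (u.1 ∈ range G.vertex → a = 0) →
        c.runningCost G z₀ a₀ s₀ - ε
          + ∑ i, q i * (G.edge i).indicator (fun _ => (inner ℝ (G.dir i) a : ℝ)) u.1
          - ∑ i, q i * (G.edge i).indicator (fun _ => (inner ℝ (G.dir i) a₀ : ℝ)) z₀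
          ≤ c.runningCost G u.1 a u.2 := by
  -- Slopes of the tangents at the velocity `a₀`; at a vertex this is velocity zero on every
  -- incident edge. For an edge missing `z₀` the value is immaterial, since both indicators vanish
  -- near `z₀`.
  refine ⟨fun i => deriv (fun a => c.ℓ i (G.coord i z₀) a s₀) (inner ℝ (G.dir i) a₀),
    fun ε hε => ?_⟩
  have hfst : Tendsto (fun u : EuclideanSpace ℝ (Fin d) × ℝ => u.1) (𝓝 (z₀, s₀)) (𝓝 z₀) :=
    continuous_fst.tendsto _
  have hsnd : Tendsto (fun u : EuclideanSpace ℝ (Fin d) × ℝ => u.2) (𝓝 (z₀, s₀)) (𝓝 s₀) :=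
    continuous_snd.tendsto _
  have e1 := hfst.eventually (Network.eventually_mem_edge_imp hG z₀)
  have e2 := hfst.eventually (G.eventually_mem_range_vertex_imp z₀)
  have e3 : ∀ᶠ u : EuclideanSpace ℝ (Fin d) × ℝ in 𝓝 (z₀, s₀), ∀ i, z₀ ∈ G.edge i →
      (G.coord i u.1, u.2) ∈ G.dom i ×ˢ Icc 0 T → ∀ a : ℝ,
      c.ℓ i (G.coord i z₀) (inner ℝ (G.dir i) a₀) s₀ +
        deriv (fun a => c.ℓ i (G.coord i z₀) a s₀) (inner ℝ (G.dir i) a₀) *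
          (a - inner ℝ (G.dir i) a₀) - ε ≤ c.ℓ i (G.coord i u.1) a u.2 := by
    refine eventually_all.2 fun i => ?_
    by_cases hi : z₀ ∈ G.edge i
    · have h1 := eventually_nhdsWithin_iff.1 ((h.edge i).eventually_tangent_le hp h.pos
        (Network.coord_mem_dom hG hi) hs₀ (inner ℝ (G.dir i) a₀) hε)
      have h2 : Continuous fun u : EuclideanSpace ℝ (Fin d) × ℝ => (G.coord i u.1, u.2) :=
        ((G.continuous_coord i).comp continuous_fst).prodMk continuous_snd
      filter_upwards [(h2.tendsto (z₀, s₀)).eventually h1] with u hu _ hmem a using hu hmem a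
    · exact Eventually.of_forall fun u hu => absurd hu hi
  have e4 : ∀ᶠ u : EuclideanSpace ℝ (Fin d) × ℝ in 𝓝 (z₀, s₀), ∀ j, z₀ = G.vertex j →
      u.2 ∈ Icc 0 T → c.vertexCost G j s₀ - ε ≤ c.vertexCost G j u.2 := by
    refine eventually_all.2 fun j => ?_
    have h1 := (h.continuousOn_vertexCost hG j s₀ hs₀).eventually
      (eventually_gt_nhds (show c.vertexCost G j s₀ - ε < _ by linarith))
    filter_upwards [hsnd.eventually (eventually_nhdsWithin_iff.1 h1)] with u hu _ hT
    exact (hu hT).le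
  filter_upwards [e1, e2, e3, e4] with u h1 h2 h3 h4 hc hT a ha
  by_cases hv : u.1 ∈ range G.vertex
  · have hu := h2 hv
    have ha0 := ha hv
    have hv₀ : z₀ ∈ range G.vertex := hu ▸ hv
    have ha₀0 := ha₀ hv₀
    obtain ⟨j, rfl⟩ := hv₀
    subst ha0 ha₀0
    rw [hu, NetworkCosts.runningCost_vertex hG, NetworkCosts.runningCost_vertex hG]
    simp only [inner_zero_right, indicator_zero, mul_zero, Finset.sum_const_zero]
    linarith [h4 j rfl hT]
  · obtain ⟨i, hi⟩ := Network.mem_carrier.1 hc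
    have hi₀ := h1 i hi
    have h5 := h3 i hi₀ ⟨Network.coord_mem_dom hG hi, hT⟩ (inner ℝ (G.dir i) a)
    rw [NetworkCosts.runningCost_of_mem_edge hG hi hv]
    have hsum1 : ∀ q : Fin m → ℝ, ∑ k, q k * (G.edge k).indicator
        (fun _ => (inner ℝ (G.dir k) a : ℝ)) u.1 = q i * inner ℝ (G.dir i) a := by
      intro q
      rw [Finset.sum_eq_single i, indicator_of_mem hi]
      · intro k _ hk
        rw [indicator_of_notMem (fun hk' => hk (Network.eq_of_mem_edge hG hi hv hk')), mul_zero]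
      · simp
    have hsum2 : ∀ q : Fin m → ℝ, ∑ k, q k * (G.edge k).indicator
        (fun _ => (inner ℝ (G.dir k) a₀ : ℝ)) z₀ = q i * inner ℝ (G.dir i) a₀ := by
      intro q
      rw [Finset.sum_eq_single i, indicator_of_mem hi₀]
      · intro k _ hk
        by_cases hk' : z₀ ∈ G.edge k
        · rw [ha₀ (Network.mem_range_vertex hG hk hk' hi₀)]
          simp
        · rw [indicator_of_notMem hk', mul_zero]
      · simp
    -- If `z₀` is a vertex and `u.1` lies on an incident edge, the tangent on that edge starts from
    -- its cost at zero velocity, which is at least the vertex cost because the latter is a minimum.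
    have h6 : c.runningCost G z₀ a₀ s₀ ≤ c.ℓ i (G.coord i z₀) (inner ℝ (G.dir i) a₀) s₀ := by
      by_cases hv₀ : z₀ ∈ range G.vertex
      · have ha₀0 := ha₀ hv₀
        obtain ⟨j, rfl⟩ := hv₀
        subst ha₀0
        rw [NetworkCosts.runningCost_vertex hG, inner_zero_right]
        exact vertexCost_le j hi₀ s₀
      · rw [NetworkCosts.runningCost_of_mem_edge hG hi₀ hv₀]
    rw [hsum1, hsum2]
    linarith

/-- The edge costs are controlled only on their domains, so they are cut off by zero outside; each
piece is then Borel measurable, being continuous on a measurable set. -/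
theorem measurable_indicator_runningCost (h : CostBounds c G p T C₀ c₀) (hG : G.Valid) :
    Measurable (((G.carrier ×ˢ univ ×ˢ Icc 0 T :
        Set (EuclideanSpace ℝ (Fin d) × EuclideanSpace ℝ (Fin d) × ℝ))).indicator
      fun u => c.runningCost G u.1 u.2.1 u.2.2) := by
  classical
  have hmeas : ∀ i, MeasurableSet (G.edge i) := fun i => (Network.isClosed_edge hG i).measurableSet
  have hV : MeasurableSet (range G.vertex) := (finite_range _).measurableSet
  have h1 : ∀ i, Measurable ((G.dom i ×ˢ univ ×ˢ Icc 0 T : Set (ℝ × ℝ × ℝ)).indicator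
      fun u => c.ℓ i u.1 u.2.1 u.2.2) := by
    intro i
    have hms : MeasurableSet (G.dom i ×ˢ univ ×ˢ Icc 0 T : Set (ℝ × ℝ × ℝ)) :=
      (G.isClosed_dom i).measurableSet.prod (MeasurableSet.univ.prod measurableSet_Icc)
    rw [← piecewise_eq_indicator]
    exact (h.edge i).continuousOn.measurable_piecewise continuousOn_const hms
  have h2 : ∀ j, Measurable ((Icc 0 T).indicator (c.vertexCost G j)) := by
    intro j
    rw [← piecewise_eq_indicator]
    exact (h.continuousOn_vertexCost hG j).measurable_piecewise continuousOn_const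
      measurableSet_Icc
  have h3 : (((G.carrier ×ˢ univ ×ˢ Icc 0 T :
        Set (EuclideanSpace ℝ (Fin d) × EuclideanSpace ℝ (Fin d) × ℝ))).indicator
      fun u => c.runningCost G u.1 u.2.1 u.2.2) = fun u =>
      (∑ i, ((fun u : EuclideanSpace ℝ (Fin d) × EuclideanSpace ℝ (Fin d) × ℝ => u.1) ⁻¹'
          (G.edge i \ range G.vertex)).indicator (fun u =>
        (G.dom i ×ˢ univ ×ˢ Icc 0 T : Set (ℝ × ℝ × ℝ)).indicator
          (fun u => c.ℓ i u.1 u.2.1 u.2.2)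
          (G.coord i u.1, inner ℝ (G.dir i) u.2.1, u.2.2)) u) +
      ∑ j, ((fun u : EuclideanSpace ℝ (Fin d) × EuclideanSpace ℝ (Fin d) × ℝ => u.1) ⁻¹'
          {G.vertex j}).indicator (fun u => (Icc 0 T).indicator (c.vertexCost G j) u.2.2) u := by
    funext ⟨z, a, τ⟩
    by_cases hτ : τ ∈ Icc 0 T
    · by_cases hz : z ∈ G.carrier
      · rw [indicator_of_mem (show (z, a, τ) ∈ G.carrier ×ˢ univ ×ˢ Icc 0 T from
          ⟨hz, mem_univ _, hτ⟩)]
        simp only [NetworkCosts.runningCost]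
        congr 1
        · refine Finset.sum_congr rfl fun i _ => ?_
          by_cases hi : z ∈ G.edge i \ range G.vertex
          · rw [indicator_of_mem hi, indicator_of_mem (by exact hi), indicator_of_mem]
            exact ⟨Network.coord_mem_dom hG hi.1, mem_univ _, hτ⟩
          · rw [indicator_of_notMem hi, indicator_of_notMem (by exact hi)]
        · refine Finset.sum_congr rfl fun j _ => ?_
          by_cases hj : z ∈ ({G.vertex j} : Set (EuclideanSpace ℝ (Fin d)))
          · rw [indicator_of_mem hj, indicator_of_mem (by exact hj), indicator_of_mem hτ]
          · rw [indicator_of_notMem hj, indicator_of_notMem (by exact hj)]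
      · rw [indicator_of_notMem (fun h' => hz h'.1), Finset.sum_eq_zero, Finset.sum_eq_zero,
          add_zero]
        · refine fun j _ => indicator_of_notMem (fun h' => hz ?_) _
          have : z = G.vertex j := h'
          exact this ▸ hG.vertex_mem j
        · exact fun i _ => indicator_of_notMem
            (fun h' => hz (Network.mem_carrier.2 ⟨i, h'.1⟩)) _
    · rw [indicator_of_notMem (fun h' => hτ h'.2.2), Finset.sum_eq_zero, Finset.sum_eq_zero,
        add_zero]
      · intro j _
        exact indicator_apply_eq_zero.2 fun _ => indicator_of_notMem hτ _
      · intro i _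
        refine indicator_apply_eq_zero.2 fun _ => indicator_of_notMem (fun h' => hτ h'.2.2) _
  rw [h3]
  refine (Finset.measurable_sum _ fun i _ => ?_).add (Finset.measurable_sum _ fun j _ => ?_)
  · refine Measurable.indicator ((h1 i).comp ?_) (measurable_fst ((hmeas i).diff hV))
    have := (G.continuous_coord i).measurable
    fun_prop
  · exact ((h2 j).comp (measurable_snd.comp measurable_snd)).indicator
      (measurable_fst (measurableSet_singleton _))

theorem exists_abs_terminalCost_le (h : CostBounds c G p T C₀ c₀) (hG : G.Valid) :
    ∃ B : ℝ, 0 ≤ B ∧ ∀ z ∈ G.carrier, |c.terminalCost G z| ≤ B := by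
  choose C hC using fun i => (h.terminal i).2
  refine ⟨∑ i, |C i| + ∑ j, |c.terminalCost G (G.vertex j)|, by positivity, fun z hz => ?_⟩
  by_cases hv : z ∈ range G.vertex
  · obtain ⟨j, rfl⟩ := hv
    have h1 := Finset.single_le_sum (f := fun j => |c.terminalCost G (G.vertex j)|)
      (fun j _ => abs_nonneg _) (Finset.mem_univ j)
    have h2 : 0 ≤ ∑ i, |C i| := by positivity
    linarith
  · obtain ⟨i, hi⟩ := Network.mem_carrier.1 hz
    rw [NetworkCosts.terminalCost_of_mem_edge hG hi hv]
    have h1 := Finset.single_le_sum (f := fun i => |C i|)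
      (fun j _ => abs_nonneg _) (Finset.mem_univ i)
    have h2 : 0 ≤ ∑ j, |c.terminalCost G (G.vertex j)| := by positivity
    linarith [hC i _ (Network.coord_mem_dom hG hi), le_abs_self (C i)]

/-- The terminal cost is lower semicontinuous on the network. -/
theorem eventually_le_terminalCost (h : CostBounds c G p T C₀ c₀) (hG : G.Valid)
    (z₀ : EuclideanSpace ℝ (Fin d)) {ε : ℝ} (hε : 0 < ε) :
    ∀ᶠ z in 𝓝 z₀, z ∈ G.carrier → c.terminalCost G z₀ - ε ≤ c.terminalCost G z := by
  have e1 : ∀ᶠ z in 𝓝 z₀, ∀ i, z₀ ∈ G.edge i → G.coord i z ∈ G.dom i →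
      c.g i (G.coord i z₀) - ε ≤ c.g i (G.coord i z) := by
    refine eventually_all.2 fun i => ?_
    by_cases hi : z₀ ∈ G.edge i
    · have h1 := eventually_nhdsWithin_iff.1 (((h.terminal i).1 _
        (Network.coord_mem_dom hG hi)).eventually
        (eventually_gt_nhds (show c.g i (G.coord i z₀) - ε < _ by linarith)))
      filter_upwards [((G.continuous_coord i).tendsto z₀).eventually h1] with z hz _ hm
      exact (hz hm).le
    · exact Eventually.of_forall fun z hz => absurd hz hi
  filter_upwards [e1, Network.eventually_mem_edge_imp hG z₀,
    G.eventually_mem_range_vertex_imp z₀] with z h1 h2 h3 hz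
  by_cases hv : z ∈ range G.vertex
  · rw [h3 hv]; linarith
  · obtain ⟨i, hi⟩ := Network.mem_carrier.1 hz
    rw [NetworkCosts.terminalCost_of_mem_edge hG hi hv]
    refine le_trans ?_ (h1 i (h2 i hi) (Network.coord_mem_dom hG hi))
    gcongr
    -- At a vertex the minimum in the terminal cost lies below the limit along each incident edge.
    by_cases hv₀ : z₀ ∈ range G.vertex
    · obtain ⟨j, rfl⟩ := hv₀
      rw [NetworkCosts.terminalCost_vertex hG]
      exact (min_le_right _ _).trans (ciInf_le (f := fun i : {i : Fin m // G.vertex j ∈ G.edge i} =>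
        c.g i.1 (G.coord i.1 (G.vertex j))) (finite_range _).bddBelow ⟨i, h2 i hi⟩)
    · rw [NetworkCosts.terminalCost_of_mem_edge hG (h2 i hi) hv₀]

end CostBounds

/-! ### Trajectories -/

theorem MemW1p.hasWeakDeriv_weakDeriv {E : Type*} [NormedAddCommGroup E] [NormedSpace ℝ E]
    {p a b : ℝ} {y : ℝ → E} (h : MemW1p p a b y) : HasWeakDeriv a b y (weakDeriv a b y) := by
  obtain ⟨v, hv, -⟩ := h.2
  have hex : ∃ v, HasWeakDeriv a b y v := ⟨v, hv⟩
  rw [weakDeriv, dif_pos hex]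
  exact hex.choose_spec

/-- The smallness of `δ` is what later yields equi-absolute continuity of trajectories with bounded
cost. -/
theorem exists_le_add_rpow {p δ : ℝ} (hp : 1 < p) (hδ : 0 < δ) :
    ∃ Λ : ℝ, 0 ≤ Λ ∧ ∀ x : ℝ, 0 ≤ x → x ≤ Λ + δ * x ^ p := by
  obtain ⟨A, hA0, hA⟩ := exists_abs_gt_imp_le_rpow hp hδ 1 0
  refine ⟨A, hA0, fun x hx => ?_⟩
  have h0 : 0 ≤ δ * x ^ p := by positivity
  rcases le_or_gt x A with h | h
  · linarith
  · have := hA x (by rwa [abs_of_nonneg hx])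
    rw [abs_of_nonneg hx] at this
    linarith

variable {d n m : ℕ} {c : NetworkCosts n m} {G : Network d n m} {p T C₀ c₀ t : ℝ}
  {x : EuclideanSpace ℝ (Fin d)} {y v : ℝ → EuclideanSpace ℝ (Fin d)}

/-- `y` is an admissible trajectory with velocity `v`. -/
structure IsTrajectory (G : Network d n m) (p T t : ℝ) (x : EuclideanSpace ℝ (Fin d))
    (y v : ℝ → EuclideanSpace ℝ (Fin d)) : Prop where
  isPrimitive : IsPrimitive t T y v
  memLp : MemLp v (ENNReal.ofReal p) (volume.restrict (Ioo t T))
  mapsTo : MapsTo y (Icc t T) G.carrier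
  init : y t = x

theorem isTrajectory_weakDeriv (hp : 1 < p) (ht : t ≤ T)
    (h : y ∈ admissible G.carrier p T t x) : IsTrajectory G p T t x y (weakDeriv t T y) := by
  obtain ⟨h1, h2, h3, h4⟩ := h
  have hW := h3.hasWeakDeriv_weakDeriv
  obtain ⟨w, hw, hwp⟩ := h3.2
  have hL : MemLp (weakDeriv t T y) (ENNReal.ofReal p) (volume.restrict (Ioo t T)) :=
    (memLp_congr_ae ((ae_restrict_iff' measurableSet_Ioo).2 (hW.ae_eq hw))).2 hwp
  refine ⟨hW.isPrimitive ht h1 (hL.integrable ?_), hL, h2, h4⟩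
  rw [← ENNReal.ofReal_one]
  exact ENNReal.ofReal_le_ofReal hp.le

namespace IsTrajectory

theorem continuousOn (h : IsTrajectory G p T t x y v) (ht : t ≤ T) : ContinuousOn y (Icc t T) :=
  h.isPrimitive.continuousOn ht

theorem mem_admissible (h : IsTrajectory G p T t x y v) (ht : t ≤ T) :
    y ∈ admissible G.carrier p T t x := by
  refine ⟨h.continuousOn ht, h.mapsTo, ⟨?_, v, h.isPrimitive.hasWeakDeriv ht, h.memLp⟩, h.init⟩
  obtain ⟨B, hB⟩ := isCompact_Icc.exists_bound_of_continuousOn (h.continuousOn ht)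
  refine MemLp.of_bound ((h.continuousOn ht).mono
    Ioo_subset_Icc_self |>.aestronglyMeasurable measurableSet_Ioo) B ?_
  exact (ae_restrict_iff' measurableSet_Ioo).2
    (Eventually.of_forall fun s hs => hB s (Ioo_subset_Icc_self hs))

theorem weakDeriv_ae_eq (h : IsTrajectory G p T t x y v) (ht : t ≤ T) :
    ∀ᵐ s, s ∈ Ioo t T → weakDeriv t T y s = v s :=
  (h.mem_admissible ht).2.2.1.hasWeakDeriv_weakDeriv.ae_eq (h.isPrimitive.hasWeakDeriv ht)

theorem cost_eq (h : IsTrajectory G p T t x y v) (ht : t ≤ T)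
    (L : EuclideanSpace ℝ (Fin d) → EuclideanSpace ℝ (Fin d) → ℝ → ℝ)
    (g : EuclideanSpace ℝ (Fin d) → ℝ) :
    cost L g T t y = (∫ τ in Ioo t T, L (y τ) (v τ) τ) + g (y T) := by
  rw [cost]
  congr 1
  refine integral_congr_ae ((ae_restrict_iff' measurableSet_Ioo).2 ?_)
  filter_upwards [h.weakDeriv_ae_eq ht] with s hs hsI
  rw [hs hsI]

theorem ae_isVelocity (h : IsTrajectory G p T t x y v) (hG : G.Valid) (ht : t ≤ T) :
    ∀ᵐ s, s ∈ Ioo t T → G.IsVelocity (y s) (v s) :=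
  Network.ae_isVelocity hG (h.isPrimitive.ae_hasDerivAt ht) h.mapsTo

theorem integrableOn_norm_rpow (h : IsTrajectory G p T t x y v) (hp : 1 < p) :
    IntegrableOn (fun s => ‖v s‖ ^ p) (Ioo t T) := by
  have := h.memLp.integrable_norm_rpow (by simpa using by linarith) ENNReal.ofReal_ne_top
  rwa [ENNReal.toReal_ofReal (by linarith)] at this

theorem integrableOn_runningCost (h : IsTrajectory G p T t x y v) (hc : CostBounds c G p T C₀ c₀)
    (hG : G.Valid) (hp : 1 < p) (ht : t ∈ Icc 0 T) :
    IntegrableOn (fun τ => c.runningCost G (y τ) (v τ) τ) (Ioo t T) := by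
  have hsub : Ioo t T ⊆ Icc 0 T := fun τ hτ => ⟨ht.1.trans hτ.1.le, hτ.2.le⟩
  obtain ⟨B, hB⟩ := isCompact_Icc.exists_bound_of_continuousOn (h.continuousOn ht.2)
  obtain ⟨C, hC0, hC⟩ := hc.exists_abs_runningCost_le hG hp (abs_nonneg B)
  have hint : IntegrableOn (fun τ => C * (1 + ‖v τ‖ ^ p)) (Ioo t T) :=
    ((integrableOn_const (by simp)).add (h.integrableOn_norm_rpow hp)).const_mul C
  refine Integrable.mono' hint ?_ ?_
  · have hy : AEMeasurable y (volume.restrict (Ioo t T)) :=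
      ((h.continuousOn ht.2).mono Ioo_subset_Icc_self).aemeasurable measurableSet_Ioo
    have hm := (hc.measurable_indicator_runningCost hG).comp_aemeasurable
      (hy.prodMk (h.memLp.1.aemeasurable.prodMk aemeasurable_id))
    refine hm.aestronglyMeasurable.congr ((ae_restrict_iff' measurableSet_Ioo).2 ?_)
    refine Eventually.of_forall fun τ hτ => indicator_of_mem ?_ _
    exact ⟨h.mapsTo (Ioo_subset_Icc_self hτ), mem_univ _, hsub hτ⟩
  · refine (ae_restrict_iff' measurableSet_Ioo).2 (Eventually.of_forall fun τ hτ => ?_)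
    exact hC _ (h.mapsTo (Ioo_subset_Icc_self hτ))
      ((hB τ (Ioo_subset_Icc_self hτ)).trans (le_abs_self B)) _ τ (hsub hτ)

theorem ae_le_runningCost (h : IsTrajectory G p T t x y v) (hc : CostBounds c G p T C₀ c₀)
    (hG : G.Valid) (hp : 1 < p) (ht : t ∈ Icc 0 T) :
    ∀ᵐ τ, τ ∈ Ioo t T → C₀ * ‖v τ‖ ^ p ≤ c.runningCost G (y τ) (v τ) τ - c₀ := by
  filter_upwards [h.ae_isVelocity hG ht.2] with τ h1 hτ
  have := hc.le_runningCost hG hp (h.mapsTo (Ioo_subset_Icc_self hτ)) (h1 hτ)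
    (τ := τ) ⟨ht.1.trans hτ.1.le, hτ.2.le⟩
  linarith

theorem integral_norm_rpow_le (h : IsTrajectory G p T t x y v) (hc : CostBounds c G p T C₀ c₀)
    (hG : G.Valid) (hp : 1 < p) (ht : t ∈ Icc 0 T) :
    C₀ * (∫ τ in Ioo t T, ‖v τ‖ ^ p) + c₀ * (T - t) ≤
      ∫ τ in Ioo t T, c.runningCost G (y τ) (v τ) τ := by
  have h1 : C₀ * (∫ τ in Ioo t T, ‖v τ‖ ^ p) + c₀ * (T - t) =
      ∫ τ in Ioo t T, (C₀ * ‖v τ‖ ^ p + c₀) := by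
    rw [integral_add ((h.integrableOn_norm_rpow hp).const_mul C₀) (integrable_const _),
      integral_const_mul]
    simp [ht.2, mul_comm]
  rw [h1]
  refine integral_mono_ae (((h.integrableOn_norm_rpow hp).const_mul C₀).add (integrable_const _))
    (h.integrableOn_runningCost hc hG hp ht) ((ae_restrict_iff' measurableSet_Ioo).2 ?_)
  filter_upwards [h.ae_le_runningCost hc hG hp ht] with τ h2 hτ
  linarith [h2 hτ]

theorem intervalIntegrable_excess (h : IsTrajectory G p T t x y v)
    (hc : CostBounds c G p T C₀ c₀) (hG : G.Valid) (hp : 1 < p) (ht : t ∈ Icc 0 T) :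
    IntervalIntegrable (fun τ => c.runningCost G (y τ) (v τ) τ - c₀) volume t T :=
  ((intervalIntegrable_iff_integrableOn_Ioo_of_le ht.2).2
    (h.integrableOn_runningCost hc hG hp ht)).sub intervalIntegrable_const

theorem integral_excess (h : IsTrajectory G p T t x y v) (hc : CostBounds c G p T C₀ c₀)
    (hG : G.Valid) (hp : 1 < p) (ht : t ∈ Icc 0 T) :
    ∫ τ in t..T, (c.runningCost G (y τ) (v τ) τ - c₀) =
      (∫ τ in Ioo t T, c.runningCost G (y τ) (v τ) τ) - c₀ * (T - t) := by
  rw [intervalIntegral.integral_sub ((intervalIntegrable_iff_integrableOn_Ioo_of_le ht.2).2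
    (h.integrableOn_runningCost hc hG hp ht)) intervalIntegrable_const,
    intervalIntegral.integral_const, intervalIntegral.integral_of_le ht.2,
    integral_Ioc_eq_integral_Ioo, smul_eq_mul, mul_comm c₀]

end IsTrajectory

theorem isTrajectory_const (hx : x ∈ G.carrier) : IsTrajectory G p T t x (fun _ => x) 0 :=
  ⟨⟨intervalIntegrable_const (c := 0), fun r _ s _ => by simp⟩, MemLp.zero, fun _ _ => hx, rfl⟩

/-- The trajectories have a modulus of continuity in terms of the excess cost. -/
theorem CostBounds.exists_dist_le (hc : CostBounds c G p T C₀ c₀) (hG : G.Valid) (hp : 1 < p)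
    (ht : t ∈ Icc 0 T) {δ : ℝ} (hδ : 0 < δ) :
    ∃ Λ : ℝ, 0 ≤ Λ ∧ ∀ x y v, IsTrajectory G p T t x y v → ∀ r ∈ Icc t T, ∀ s ∈ Icc t T, r ≤ s →
      dist (y r) (y s) ≤ Λ * (s - r) +
        δ * ∫ τ in r..s, (c.runningCost G (y τ) (v τ) τ - c₀) := by
  -- With the factor `δ * C₀`, coercivity gives `‖v‖ ≤ Λ + δ * (L - c₀)`.
  obtain ⟨Λ, hΛ0, hΛ⟩ := exists_le_add_rpow hp (mul_pos hδ hc.pos)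
  refine ⟨Λ, hΛ0, fun x y v h r hr s hs hrs => ?_⟩
  have hsub : uIcc r s ⊆ uIcc t T := by
    rw [uIcc_of_le hrs, uIcc_of_le ht.2]
    exact Icc_subset_Icc hr.1 hs.2
  have hi := (h.intervalIntegrable_excess hc hG hp ht).mono_set hsub
  have hnorm := h.isPrimitive.norm_sub_le hr hs hrs
  rw [dist_comm, dist_eq_norm]
  refine hnorm.trans ?_
  calc ∫ τ in r..s, ‖v τ‖
      ≤ ∫ τ in r..s, (Λ + δ * (c.runningCost G (y τ) (v τ) τ - c₀)) := by
        refine intervalIntegral.integral_mono_ae_restrict hrs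
          (h.isPrimitive.intervalIntegrable.mono_set hsub).norm
          (intervalIntegrable_const.add (hi.const_mul δ)) ?_
        rw [Filter.EventuallyLE, ← restrict_Ioo_eq_restrict_Icc]
        refine (ae_restrict_iff' measurableSet_Ioo).2 ?_
        filter_upwards [h.ae_le_runningCost hc hG hp ht] with τ h1 hτ
        have h2 := h1 ⟨hr.1.trans_lt hτ.1, hτ.2.trans_le hs.2⟩
        have h3 := hΛ ‖v τ‖ (norm_nonneg _)
        nlinarith
    _ = _ := by
        rw [intervalIntegral.integral_add intervalIntegrable_const (hi.const_mul δ),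
          intervalIntegral.integral_const, intervalIntegral.integral_const_mul, smul_eq_mul,
          mul_comm Λ]

/-! ### A priori bounds -/

theorem CostBounds.integrableOn_and_bddBelow (hc : CostBounds c G p T C₀ c₀) (hG : G.Valid)
    (hp : 1 < p) (ht : t ∈ Icc 0 T) :
    (∀ y ∈ admissible G.carrier p T t x,
      IntegrableOn (fun τ => c.runningCost G (y τ) (weakDeriv t T y τ) τ) (Ioo t T)) ∧
    BddBelow (cost (c.runningCost G) (c.terminalCost G) T t '' admissible G.carrier p T t x) := by
  refine ⟨fun y hy =>
    (isTrajectory_weakDeriv hp ht.2 hy).integrableOn_runningCost hc hG hp ht, ?_⟩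
  obtain ⟨B, hB0, hB⟩ := hc.exists_abs_terminalCost_le hG
  refine ⟨c₀ * (T - t) - B, ?_⟩
  rintro _ ⟨y, hy, rfl⟩
  have htr := isTrajectory_weakDeriv hp ht.2 hy
  have h1 := htr.integral_norm_rpow_le hc hG hp ht
  have h2 : 0 ≤ C₀ * ∫ τ in Ioo t T, ‖weakDeriv t T y τ‖ ^ p :=
    mul_nonneg hc.pos.le (integral_nonneg fun τ => by positivity)
  have h3 := (abs_le.1 (hB _ (htr.mapsTo ⟨ht.2, le_rfl⟩))).1
  rw [cost]
  linarith

theorem CostBounds.value_le_cost (hc : CostBounds c G p T C₀ c₀) (hG : G.Valid)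
    (hp : 1 < p) (ht : t ∈ Icc 0 T) (h : IsTrajectory G p T t x y v) :
    value G.carrier (c.runningCost G) (c.terminalCost G) p T x t ≤
      (∫ τ in Ioo t T, c.runningCost G (y τ) (v τ) τ) + c.terminalCost G (y T) := by
  rw [← h.cost_eq ht.2]
  exact csInf_le (hc.integrableOn_and_bddBelow hG hp ht).2
    (mem_image_of_mem _ (h.mem_admissible ht.2))

/-- Staying at `x` is admissible, and its cost is bounded uniformly for `x` in a bounded set. -/
theorem CostBounds.exists_value_le (hc : CostBounds c G p T C₀ c₀) (hG : G.Valid) (hp : 1 < p)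
    {r : ℝ} (hr : 0 ≤ r) :
    ∃ K : ℝ, ∀ x ∈ G.carrier, ‖x‖ ≤ r → ∀ t ∈ Icc 0 T,
      value G.carrier (c.runningCost G) (c.terminalCost G) p T x t ≤ K := by
  obtain ⟨C, hC0, hC⟩ := hc.exists_abs_runningCost_le hG hp hr
  obtain ⟨B, hB0, hB⟩ := hc.exists_abs_terminalCost_le hG
  refine ⟨C * T + B, fun x hx hxr t ht => ?_⟩
  have htr := isTrajectory_const (p := p) (T := T) (t := t) hx
  refine (hc.value_le_cost hG hp ht htr).trans (add_le_add ?_ ((le_abs_self _).trans (hB x hx)))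
  calc ∫ τ in Ioo t T, c.runningCost G x ((0 : ℝ → EuclideanSpace ℝ (Fin d)) τ) τ
      ≤ ∫ τ in Ioo t T, C := by
        refine setIntegral_mono_on (htr.integrableOn_runningCost hc hG hp ht)
          (integrableOn_const (by simp)) measurableSet_Ioo fun τ hτ => ?_
        have := (le_abs_self _).trans
          (hC x hx hxr 0 τ ⟨ht.1.trans hτ.1.le, hτ.2.le⟩)
        rw [norm_zero, Real.zero_rpow (by linarith), add_zero, mul_one] at this
        exact this
    _ = C * (T - t) := by simp [ht.2, mul_comm]
    _ ≤ C * T := by nlinarith [ht.1]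

theorem CostBounds.exists_bounds (hc : CostBounds c G p T C₀ c₀) (hG : G.Valid) (hp : 1 < p)
    (hT : 0 < T) {r : ℝ} (hr : 0 ≤ r) :
    ∃ M R : ℝ, 0 < M ∧ 0 < R ∧ ∀ x ∈ G.carrier, ‖x‖ ≤ r → ∀ t ∈ Icc 0 T,
      ∀ y ∈ optimal G.carrier (c.runningCost G) (c.terminalCost G) p T t x,
        normW1p p t T y ≤ ENNReal.ofReal M ∧ ∀ s ∈ Icc t T, ‖y s‖ ≤ R := by
  have hp0 : 0 < p := by linarith
  obtain ⟨K, hK⟩ := hc.exists_value_le hG hp hr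
  obtain ⟨B, hB0, hB⟩ := hc.exists_abs_terminalCost_le hG
  -- Bound for `∫ ‖v‖ ^ p`, obtained from `C₀ * ∫ ‖v‖ ^ p + c₀ * (T - t) ≤ u - g(y T) ≤ K + B`.
  set Q := (|K| + |c₀| * T + B) / C₀ with hQ
  have hQ0 : 0 ≤ Q := div_nonneg (by positivity) hc.pos.le
  -- Since `‖v‖ ≤ 1 + ‖v‖ ^ p`, the path has length at most `T + Q`; the summand `1` makes the bound
  -- positive.
  set R := r + T + Q + 1 with hR
  have hR0 : 0 < R := by positivity
  set N : ℝ≥0∞ := (((ENNReal.ofReal T) ^ (ENNReal.ofReal p).toReal⁻¹ * ENNReal.ofReal R) ^ p +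
    ENNReal.ofReal Q) ^ (1 / p) with hN
  have hNtop : N ≠ ∞ := by
    refine ENNReal.rpow_ne_top_of_nonneg (by positivity) (ENNReal.add_ne_top.2
      ⟨ENNReal.rpow_ne_top_of_nonneg hp0.le (ENNReal.mul_ne_top
        (ENNReal.rpow_ne_top_of_nonneg (by positivity) ENNReal.ofReal_ne_top)
        ENNReal.ofReal_ne_top), ENNReal.ofReal_ne_top⟩)
  refine ⟨N.toReal + 1, R, by positivity, hR0, fun x hx hxr t ht y hy => ?_⟩
  have htr := isTrajectory_weakDeriv hp ht.2 hy.1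
  set v := weakDeriv t T y with hv
  have hTt : T - t ≤ T := by linarith [ht.1]
  have hE : ∫ τ in Ioo t T, ‖v τ‖ ^ p ≤ Q := by
    have h1 := htr.integral_norm_rpow_le hc hG hp ht
    have h2 := hK x hx hxr t ht
    have h3 := (abs_le.1 (hB _ (htr.mapsTo ⟨ht.2, le_rfl⟩))).1
    have h4 := hy.2
    rw [cost, ← hv] at h4
    rw [hQ, le_div_iff₀ hc.pos]
    have h5 : -(|c₀| * T) ≤ c₀ * (T - t) := by
      have := neg_abs_le c₀
      have h6 : 0 ≤ T - t := by linarith [ht.2]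
      nlinarith [abs_nonneg c₀]
    nlinarith [le_abs_self K]
  have hsup : ∀ s ∈ Icc t T, ‖y s‖ ≤ R := by
    intro s hs
    have h1 := htr.isPrimitive.norm_sub_le ⟨le_rfl, ht.2⟩ hs hs.1
    rw [htr.init] at h1
    have h2 : ∫ τ in t..s, ‖v τ‖ ≤ T + Q := by
      calc ∫ τ in t..s, ‖v τ‖ ≤ ∫ τ in t..T, ‖v τ‖ := by
            refine intervalIntegral.integral_mono_interval le_rfl hs.1 hs.2
              (Eventually.of_forall fun τ => norm_nonneg _) htr.isPrimitive.intervalIntegrable.norm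
        _ = ∫ τ in Ioo t T, ‖v τ‖ := by
            rw [intervalIntegral.integral_of_le ht.2, integral_Ioc_eq_integral_Ioo]
        _ ≤ ∫ τ in Ioo t T, (1 + ‖v τ‖ ^ p) := by
            refine integral_mono ((intervalIntegrable_iff_integrableOn_Ioo_of_le ht.2).1
              htr.isPrimitive.intervalIntegrable).norm
              ((integrable_const _).add (htr.integrableOn_norm_rpow hp)) fun τ => ?_
            have hpos : 0 ≤ ‖v τ‖ ^ p := by positivity
            rcases le_total ‖v τ‖ 1 with h3 | h3
            · simp only; linarith
            · have := Real.self_le_rpow_of_one_le h3 hp.le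
              simp only; linarith
        _ = (T - t) + ∫ τ in Ioo t T, ‖v τ‖ ^ p := by
            rw [integral_add (integrable_const _) (htr.integrableOn_norm_rpow hp)]
            simp [ht.2]
        _ ≤ T + Q := by linarith
    have h3 : ‖y s‖ ≤ ‖y s - x‖ + ‖x‖ := by
      simpa using norm_add_le (y s - x) x
    linarith
  refine ⟨?_, hsup⟩
  have hN1 : normW1p p t T y ≤ N := by
    rw [normW1p, ← hv, hN]
    refine ENNReal.rpow_le_rpow (add_le_add (ENNReal.rpow_le_rpow ?_ hp0.le) ?_) (by positivity)
    · refine (eLpNorm_le_of_ae_bound (C := R) ((ae_restrict_iff' measurableSet_Ioo).2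
        (Eventually.of_forall fun s hs => hsup s (Ioo_subset_Icc_self hs)))).trans ?_
      gcongr
      rw [Measure.restrict_apply_univ, Real.volume_Ioo]
      exact ENNReal.ofReal_le_ofReal hTt
    · rw [eLpNorm_eq_lintegral_rpow_enorm_toReal (by simpa using hp0) ENNReal.ofReal_ne_top,
        ENNReal.toReal_ofReal hp0.le, ← ENNReal.rpow_mul, one_div_mul_cancel hp0.ne',
        ENNReal.rpow_one]
      refine le_trans (le_of_eq ?_) (ENNReal.ofReal_le_ofReal hE)
      rw [ofReal_integral_eq_lintegral_ofReal (htr.integrableOn_norm_rpow hp)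
        (Eventually.of_forall fun τ => by positivity)]
      refine lintegral_congr fun τ => ?_
      rw [← ENNReal.ofReal_rpow_of_nonneg (norm_nonneg _) hp0.le, ofReal_norm]
  refine hN1.trans ?_
  rw [← ENNReal.ofReal_toReal hNtop]
  refine ENNReal.ofReal_le_ofReal ?_
  rw [ENNReal.toReal_ofReal ENNReal.toReal_nonneg]
  linarith

/-! ### Lower semicontinuity and existence of optimal trajectories -/

theorem sum_integral_le_of_mem_disjWithin {φ : ℝ → ℝ} {a b : ℝ} (hab : a ≤ b)
    (hφ : IntervalIntegrable φ volume a b) (h0 : ∀ᵐ τ, τ ∈ Ioo a b → 0 ≤ φ τ)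
    {I : ℕ × (ℕ → ℝ × ℝ)} (hI : I ∈ AbsolutelyContinuousOnInterval.disjWithin a b) :
    ∑ i ∈ Finset.range I.1, ∫ τ in uIoc (I.2 i).1 (I.2 i).2, φ τ ≤ ∫ τ in a..b, φ τ := by
  have hsub := AbsolutelyContinuousOnInterval.biUnion_uIoc_subset_of_mem_disjWithin hI
  rw [uIoc_of_le hab] at hsub
  have hint : IntegrableOn φ (Ioc a b) := (intervalIntegrable_iff_integrableOn_Ioc_of_le hab).1 hφ
  rw [← integral_biUnion_finset _ (fun i _ => measurableSet_uIoc) hI.2,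
    intervalIntegral.integral_of_le hab]
  · refine setIntegral_mono_set hint ?_ hsub.eventuallyLE
    rw [← restrict_Ioo_eq_restrict_Ioc]
    exact (ae_restrict_iff' measurableSet_Ioo).2 h0
  · exact fun i hi => hint.mono_set ((subset_biUnion_of_mem (u := fun i =>
      uIoc (I.2 i).1 (I.2 i).2) hi).trans hsub)

/-- Over a disjoint family of intervals the increments of `Y k` sum to at most `Λ` times the total
length plus `δ * K`, uniformly in `k`, and a finite sum passes to the pointwise limit. -/
theorem absolutelyContinuous_of_tendsto {X : Type*} [PseudoMetricSpace X] {𝒰 : Filter ℕ}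
    [𝒰.NeBot] {Y : ℕ → ℝ → X} {y : ℝ → X} {φ : ℕ → ℝ → ℝ} {a b K : ℝ} (hab : a ≤ b)
    (hφ : ∀ k, IntervalIntegrable (φ k) volume a b)
    (h0 : ∀ k, ∀ᵐ τ, τ ∈ Ioo a b → 0 ≤ φ k τ) (hK : ∀ k, ∫ τ in a..b, φ k τ ≤ K)
    (hmod : ∀ δ > 0, ∃ Λ : ℝ, 0 ≤ Λ ∧ ∀ k, ∀ r ∈ Icc a b, ∀ s ∈ Icc a b, r ≤ s →
      dist (Y k r) (Y k s) ≤ Λ * (s - r) + δ * ∫ τ in r..s, φ k τ)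
    (hlim : ∀ s ∈ Icc a b, Tendsto (fun k => Y k s) 𝒰 (𝓝 (y s))) :
    AbsolutelyContinuousOnInterval y a b := by
  rw [absolutelyContinuousOnInterval_iff]
  intro ε hε
  -- First `δ` is chosen against `K`, then the total length against the resulting `Λ`. Each
  -- contributes `ε / 3`, which leaves room for strictness after the limit.
  obtain ⟨Λ, hΛ0, hΛ⟩ := hmod (ε / (3 * (|K| + 1))) (by positivity)
  refine ⟨ε / (3 * (Λ + 1)), by positivity, fun I hI hlen => ?_⟩
  have hmem := hI.1
  rw [uIcc_of_le hab] at hmem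
  have hstep : ∀ k, ∑ i ∈ Finset.range I.1, dist (Y k (I.2 i).1) (Y k (I.2 i).2) ≤ 2 * (ε / 3) := by
    intro k
    have h1 : ∀ i ∈ Finset.range I.1, dist (Y k (I.2 i).1) (Y k (I.2 i).2) ≤
        Λ * dist (I.2 i).1 (I.2 i).2 +
          ε / (3 * (|K| + 1)) * ∫ τ in uIoc (I.2 i).1 (I.2 i).2, φ k τ := by
      intro i hi
      rcases le_total (I.2 i).1 (I.2 i).2 with hle | hle
      · rw [uIoc_of_le hle, ← intervalIntegral.integral_of_le hle, dist_comm (I.2 i).1,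
          Real.dist_eq, abs_of_nonneg (sub_nonneg.2 hle)]
        exact hΛ k _ (hmem i hi).1 _ (hmem i hi).2 hle
      · rw [uIoc_of_ge hle, ← intervalIntegral.integral_of_le hle,
          Real.dist_eq, abs_of_nonneg (sub_nonneg.2 hle), dist_comm]
        exact hΛ k _ (hmem i hi).2 _ (hmem i hi).1 hle
    refine (Finset.sum_le_sum h1).trans ?_
    rw [Finset.sum_add_distrib, ← Finset.mul_sum, ← Finset.mul_sum]
    have h2 := (sum_integral_le_of_mem_disjWithin hab (hφ k) (h0 k) hI).trans (hK k)
    have h3 : Λ * ∑ i ∈ Finset.range I.1, dist (I.2 i).1 (I.2 i).2 ≤ ε / 3 := by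
      calc _ ≤ (Λ + 1) * (ε / (3 * (Λ + 1))) :=
            mul_le_mul (by linarith) hlen.le (Finset.sum_nonneg fun _ _ => dist_nonneg)
              (by positivity)
        _ = ε / 3 := by field_simp
    have h4 : ε / (3 * (|K| + 1)) *
        ∑ i ∈ Finset.range I.1, ∫ τ in uIoc (I.2 i).1 (I.2 i).2, φ k τ ≤ ε / 3 := by
      calc _ ≤ ε / (3 * (|K| + 1)) * (|K| + 1) := by
            gcongr
            linarith [le_abs_self K]
        _ = ε / 3 := by field_simp
    linarith
  have hlimsum : Tendsto (fun k => ∑ i ∈ Finset.range I.1, dist (Y k (I.2 i).1) (Y k (I.2 i).2)) 𝒰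
      (𝓝 (∑ i ∈ Finset.range I.1, dist (y (I.2 i).1) (y (I.2 i).2))) :=
    tendsto_finsetSum _ fun i hi => (hlim _ (hmem i hi).1).dist (hlim _ (hmem i hi).2)
  have := le_of_tendsto' hlimsum hstep
  linarith

variable {Y V : ℕ → ℝ → EuclideanSpace ℝ (Fin d)}

/-- The calibration inequality on a short time interval. -/
theorem IsTrajectory.le_integral_excess {y v : ℝ → EuclideanSpace ℝ (Fin d)}
    (h : IsTrajectory G p T t x y v)
    (hc : CostBounds c G p T C₀ c₀) (hG : G.Valid) (hp : 1 < p) (ht : t ∈ Icc 0 T)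
    {z₀ : EuclideanSpace ℝ (Fin d)} {q : Fin m → ℝ} {κ r s : ℝ} (hr : r ∈ Icc t T)
    (hs : s ∈ Icc t T) (hrs : r ≤ s) (hloc : ∀ τ ∈ Icc r s, y τ ∈ range G.vertex → y τ = z₀)
    (hle : ∀ τ ∈ Icc r s, ∀ a, (y τ ∈ range G.vertex → a = 0) →
      κ + ∑ i, q i * (G.edge i).indicator (fun _ => (inner ℝ (G.dir i) a : ℝ)) (y τ) ≤
        c.runningCost G (y τ) a τ - c₀) :
    κ * (s - r) + ∑ i, q i * (G.branch i z₀ (y s) - G.branch i z₀ (y r)) ≤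
      ∫ τ in r..s, (c.runningCost G (y τ) (v τ) τ - c₀) := by
  have hsub : Icc r s ⊆ Icc t T := Icc_subset_Icc hr.1 hs.2
  have hb : ∀ i, IsPrimitive r s (fun τ => G.branch i z₀ (y τ)) (fun τ =>
      (G.edge i).indicator (fun _ => (inner ℝ (G.dir i) (v τ) : ℝ)) (y τ)) := fun i =>
    Network.isPrimitive_branch hG i hrs (h.isPrimitive.mono hrs hsub) (h.mapsTo.mono_left hsub)
      hloc
  have hbi : ∀ i ∈ Finset.univ, IntervalIntegrable (fun τ => q i *
      (G.edge i).indicator (fun _ => (inner ℝ (G.dir i) (v τ) : ℝ)) (y τ)) volume r s :=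
    fun i _ => (hb i).intervalIntegrable.const_mul (q i)
  have hsum : IntervalIntegrable (fun τ => ∑ i, q i *
      (G.edge i).indicator (fun _ => (inner ℝ (G.dir i) (v τ) : ℝ)) (y τ)) volume r s := by
    have := IntervalIntegrable.sum Finset.univ hbi
    refine this.congr_ae (Eventually.of_forall fun τ => ?_)
    simp [Finset.sum_apply]
  have heq : κ * (s - r) + ∑ i, q i * (G.branch i z₀ (y s) - G.branch i z₀ (y r)) =
      ∫ τ in r..s, (κ + ∑ i, q i *
        (G.edge i).indicator (fun _ => (inner ℝ (G.dir i) (v τ) : ℝ)) (y τ)) := by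
    rw [intervalIntegral.integral_add intervalIntegrable_const hsum,
      intervalIntegral.integral_const, intervalIntegral.integral_finsetSum hbi, smul_eq_mul,
      mul_comm κ]
    congr 1
    refine Finset.sum_congr rfl fun i _ => ?_
    rw [intervalIntegral.integral_const_mul, ← (hb i).sub_eq r ⟨le_rfl, hrs⟩ s ⟨hrs, le_rfl⟩]
  rw [heq]
  refine intervalIntegral.integral_mono_ae_restrict hrs (intervalIntegrable_const.add hsum)
    ((h.intervalIntegrable_excess hc hG hp ht).mono_set (by
      rwa [uIcc_of_le hrs, uIcc_of_le ht.2])) ?_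
  rw [Filter.EventuallyLE, ← restrict_Ioo_eq_restrict_Icc]
  refine (ae_restrict_iff' measurableSet_Ioo).2 ?_
  filter_upwards [h.ae_isVelocity hG ht.2] with τ h1 hτ
  exact hle τ (Ioo_subset_Icc_self hτ) _
    (h1 ⟨hr.1.trans_lt hτ.1, hτ.2.trans_le hs.2⟩).1

theorem nonneg_of_hasDerivAt_of_le {f : ℝ → ℝ} {f' s h : ℝ} (hh : 0 < h) (hf : HasDerivAt f f' s)
    (hle : ∀ r ∈ Ioo s (s + h), f s ≤ f r) : 0 ≤ f' := by
  have h1 := (hasDerivWithinAt_iff_tendsto_slope' (s := Ioi s) (by simp)).1 hf.hasDerivWithinAt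
  refine ge_of_tendsto h1 ?_
  filter_upwards [Ioo_mem_nhdsGT (show s < s + h by linarith)] with r hr
  rw [slope_def_field]
  exact div_nonneg (sub_nonneg.2 (hle r hr)) (by linarith [hr.1])

/-- Pointwise lower semicontinuity. The calibration inequality holds for `Y k` on a short interval
to the right of `s`, of length independent of `k`; it passes to the limit and is differentiated at
`s`. -/
theorem runningCost_le_of_hasDerivAt (hc : CostBounds c G p T C₀ c₀) (hG : G.Valid) (hp : 1 < p)
    (ht : t ∈ Icc 0 T) (hY : ∀ k, IsTrajectory G p T t x (Y k) (V k)) {K : ℝ}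
    (hK : ∀ k, ∫ τ in t..T, (c.runningCost G (Y k τ) (V k τ) τ - c₀) ≤ K) {𝒰 : Filter ℕ}
    [𝒰.NeBot] {y : ℝ → EuclideanSpace ℝ (Fin d)} {F : ℝ → ℝ}
    (hy : ∀ s ∈ Icc t T, Tendsto (fun k => Y k s) 𝒰 (𝓝 (y s)))
    (hF : ∀ s ∈ Icc t T, Tendsto (fun k => ∫ τ in t..s,
      (c.runningCost G (Y k τ) (V k τ) τ - c₀)) 𝒰 (𝓝 (F s)))
    {s f : ℝ} {a : EuclideanSpace ℝ (Fin d)} (hs : s ∈ Ioo t T) (hFd : HasDerivAt F f s)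
    (hyd : HasDerivAt y a s) (hv : y s ∈ range G.vertex → a = 0) :
    c.runningCost G (y s) a s - c₀ ≤ f := by
  have hsI := Ioo_subset_Icc_self hs
  have hs0 : s ∈ Icc 0 T := ⟨ht.1.trans hsI.1, hsI.2⟩
  have hymem : ∀ r ∈ Icc t T, y r ∈ G.carrier := fun r hr =>
    (Network.isClosed_carrier hG).mem_of_tendsto (hy r hr)
      (Eventually.of_forall fun k => (hY k).mapsTo hr)
  have hΦ := fun k => (hY k).intervalIntegrable_excess hc hG hp ht
  have hΦ0 : ∀ k, ∀ᵐ τ, τ ∈ Ioo t T → 0 ≤ c.runningCost G (Y k τ) (V k τ) τ - c₀ := by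
    intro k
    filter_upwards [(hY k).ae_le_runningCost hc hG hp ht] with τ h1 hτ
    exact (mul_nonneg hc.pos.le (by positivity)).trans (h1 hτ)
  obtain ⟨q, hq⟩ := hc.exists_eventually_le_runningCost hG hp (hymem s hsI) hv hs0
  refine le_of_forall_pos_le_add fun ε hε => ?_
  have hev := (hq ε hε).and ((continuous_fst.tendsto (y s, s)).eventually
    (G.eventually_mem_range_vertex_imp (y s)))
  obtain ⟨δ, hδ, hδP⟩ := Metric.eventually_nhds_iff.1 hev
  -- On `[s, s + h]` the distance from `Y k` to `y s` stays below `3 * (δ / 4)`: one quarter for the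
  -- distance at time `s`, one for the excess cost, one for the term in `Λ`, through the choice of
  -- `h`.
  obtain ⟨Λ, hΛ0, hΛ⟩ := hc.exists_dist_le hG hp ht (δ := δ / (4 * (|K| + 1))) (by positivity)
  set S := ∑ i, q i * (G.edge i).indicator (fun _ => (inner ℝ (G.dir i) a : ℝ)) (y s) with hS
  set κ := c.runningCost G (y s) a s - ε - S - c₀ with hκ
  set h := min (min δ (δ / (4 * (Λ + 1)))) (T - s) with hh
  have hh0 : 0 < h := lt_min (lt_min hδ (by positivity)) (by linarith [hs.2])
  have hclose : ∀ r ∈ Icc s (s + h), ∀ k, dist (Y k s) (y s) < δ / 4 →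
      dist (Y k r) (y s) < 3 * (δ / 4) := by
    intro r hr k hk
    have hrT : r ∈ Icc t T := ⟨hsI.1.trans hr.1, hr.2.trans (by
      have := min_le_right (min δ (δ / (4 * (Λ + 1)))) (T - s)
      linarith)⟩
    have h1 := hΛ _ _ _ (hY k) s hsI r hrT hr.1
    have h2 : ∫ τ in s..r, (c.runningCost G (Y k τ) (V k τ) τ - c₀) ≤ K := by
      refine le_trans ?_ (hK k)
      refine intervalIntegral.integral_mono_interval hsI.1 hr.1 hrT.2 ?_ (hΦ k)
      rw [← restrict_Ioo_eq_restrict_Ioc]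
      exact (ae_restrict_iff' measurableSet_Ioo).2 (hΦ0 k)
    have h3 : δ / (4 * (|K| + 1)) * ∫ τ in s..r, (c.runningCost G (Y k τ) (V k τ) τ - c₀) ≤
        δ / 4 := by
      calc _ ≤ δ / (4 * (|K| + 1)) * (|K| + 1) := by
            gcongr
            linarith [le_abs_self K]
        _ = δ / 4 := by field_simp
    have h4 : Λ * (r - s) ≤ δ / 4 := by
      have h5 : r - s ≤ δ / (4 * (Λ + 1)) := by
        have h6 : h ≤ δ / (4 * (Λ + 1)) := (min_le_left _ _).trans (min_le_right _ _)
        linarith [hr.2]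
      calc _ ≤ (Λ + 1) * (δ / (4 * (Λ + 1))) :=
            mul_le_mul (by linarith) h5 (by linarith [hr.1]) (by positivity)
        _ = δ / 4 := by field_simp
    have h7 := dist_triangle_left (Y k r) (y s) (Y k s)
    linarith
  have hnear : ∀ᶠ k in 𝒰, dist (Y k s) (y s) < δ / 4 :=
    (Metric.tendsto_nhds.1 (hy s hsI)) (δ / 4) (by positivity)
  have key : ∀ r ∈ Ioo s (s + h), κ * (r - s) +
      ∑ i, q i * (G.branch i (y s) (y r) - G.branch i (y s) (y s)) ≤ F r - F s := by
    intro r hr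
    have hrle : s ≤ r := hr.1.le
    have hrT : r ∈ Icc t T := ⟨hsI.1.trans hrle, hr.2.le.trans (by
      have := min_le_right (min δ (δ / (4 * (Λ + 1)))) (T - s)
      linarith)⟩
    have hyr : dist (y r) (y s) ≤ 3 * (δ / 4) :=
      le_of_tendsto ((hy r hrT).dist tendsto_const_nhds) (by
        filter_upwards [hnear] with k hk
        exact (hclose r ⟨hrle, hr.2.le⟩ k hk).le)
    have hbr : ∀ i, ∀ r' ∈ Icc t T, (y r' ∈ range G.vertex → y r' = y s) →
        Tendsto (fun k => G.branch i (y s) (Y k r')) 𝒰 (𝓝 (G.branch i (y s) (y r'))) := by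
      intro i r' hr' hvr
      exact (Network.continuousWithinAt_branch hG i (hymem r' hr') hvr).tendsto.comp
        (tendsto_nhdsWithin_iff.2 ⟨hy r' hr', Eventually.of_forall fun k => (hY k).mapsTo hr'⟩)
    have hvr : y r ∈ range G.vertex → y r = y s := by
      refine (hδP (y := (y r, s)) ?_).2
      rw [Prod.dist_eq, dist_self]
      exact max_lt (by linarith) hδ
    refine le_of_tendsto_of_tendsto
      (tendsto_const_nhds.add (tendsto_finsetSum _ fun i _ =>
        ((hbr i r hrT hvr).sub (hbr i s hsI fun _ => rfl)).const_mul (q i)))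
      ((hF r hrT).sub (hF s hsI)) ?_
    filter_upwards [hnear] with k hk
    have hsplit : (∫ τ in t..r, (c.runningCost G (Y k τ) (V k τ) τ - c₀)) -
        ∫ τ in t..s, (c.runningCost G (Y k τ) (V k τ) τ - c₀) =
        ∫ τ in s..r, (c.runningCost G (Y k τ) (V k τ) τ - c₀) := by
      have hu : ∀ r' ∈ Icc t T, uIcc t r' ⊆ uIcc t T := by
        intro r' hr'
        rw [← uIcc_of_le ht.2] at hr'
        exact uIcc_subset_uIcc_left hr'
      exact intervalIntegral.integral_interval_sub_left ((hΦ k).mono_set (hu r hrT))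
        ((hΦ k).mono_set (hu s hsI))
    rw [hsplit]
    have hball : ∀ τ ∈ Icc s r, dist (Y k τ, τ) (y s, s) < δ := by
      intro τ hτ
      have h1 := hclose τ ⟨hτ.1, hτ.2.trans hr.2.le⟩ k hk
      have h2 : h ≤ δ := (min_le_left _ _).trans (min_le_left _ _)
      rw [Prod.dist_eq, Real.dist_eq, abs_of_nonneg (by linarith [hτ.1])]
      exact max_lt (by linarith) (by linarith [hτ.2, hr.2])
    refine (hY k).le_integral_excess hc hG hp ht hsI hrT hrle
      (fun τ hτ => (hδP (hball τ hτ)).2) fun τ hτ b hb => ?_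
    have hτT : τ ∈ Icc t T := ⟨hsI.1.trans hτ.1, hτ.2.trans hrT.2⟩
    have := (hδP (hball τ hτ)).1 ((hY k).mapsTo hτT) ⟨ht.1.trans hτT.1, hτT.2⟩ b hb
    rw [hκ]
    linarith
  have hbd : ∀ i, HasDerivAt (fun r => G.branch i (y s) (y r))
      ((G.edge i).indicator (fun _ => (inner ℝ (G.dir i) a : ℝ)) (y s)) s := fun i =>
    Network.hasDerivAt_branch hG i hyd
      (by filter_upwards [Icc_mem_nhds hs.1 hs.2] with r hr using hymem r hr)
      fun h' => ⟨rfl, hv h'⟩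
  -- By `key` this function is smallest at `s` among the times in `[s, s + h)`, so its derivative at
  -- `s` is nonnegative.
  have hder : HasDerivAt (fun r => F r - κ * (r - s) - ∑ i, q i * (G.branch i (y s) (y r) -
      G.branch i (y s) (y s))) (f - κ * 1 - S) s := by
    refine (hFd.sub (((hasDerivAt_id s).sub_const s).const_mul κ)).sub ?_
    exact HasDerivAt.fun_sum fun i _ => ((hbd i).sub_const _).const_mul (q i)
  have := nonneg_of_hasDerivAt_of_le hh0 hder (fun r hr => by
    have := key r hr
    simp only [sub_self, mul_zero, Finset.sum_const_zero, sub_zero]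
    linarith)
  rw [hκ] at this
  linarith

/-! ### Limits of minimizing sequences. -/

/-- An ultrafilter provides limits at all times at once, in place of a diagonal extraction of
subsequences. -/
theorem exists_tendsto_of_bounded {X : Type*} [PseudoMetricSpace X] [ProperSpace X]
    (𝒰 : Ultrafilter ℕ) {u : ℕ → X} {z : X} {R : ℝ} (hu : ∀ k, dist (u k) z ≤ R) :
    ∃ l, Tendsto u 𝒰 (𝓝 l) := by
  obtain ⟨l, -, hl⟩ := (isCompact_closedBall z R).ultrafilter_le_nhds (𝒰.map u)
    (le_principal_iff.2 (Eventually.of_forall (f := (𝒰 : Filter ℕ)) fun k => hu k))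
  exact ⟨l, hl⟩

theorem exists_trajectory_le (hc : CostBounds c G p T C₀ c₀) (hG : G.Valid) (hp : 1 < p)
    (ht : t ∈ Icc 0 T) (hY : ∀ k, IsTrajectory G p T t x (Y k) (V k)) {K : ℝ}
    (hK : ∀ k, ∫ τ in t..T, (c.runningCost G (Y k τ) (V k τ) τ - c₀) ≤ K) (𝒰 : Ultrafilter ℕ) :
    ∃ y v, IsTrajectory G p T t x y v ∧ Tendsto (fun k => Y k T) 𝒰 (𝓝 (y T)) ∧
      ∃ F : ℝ, Tendsto (fun k => ∫ τ in t..T, (c.runningCost G (Y k τ) (V k τ) τ - c₀)) 𝒰 (𝓝 F) ∧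
        ∫ τ in t..T, (c.runningCost G (y τ) (v τ) τ - c₀) ≤ F := by
  have hΦ := fun k => (hY k).intervalIntegrable_excess hc hG hp ht
  have hΦ0 : ∀ k, ∀ᵐ τ, τ ∈ Ioo t T → 0 ≤ c.runningCost G (Y k τ) (V k τ) τ - c₀ := by
    intro k
    filter_upwards [(hY k).ae_le_runningCost hc hG hp ht] with τ h1 hτ
    exact (mul_nonneg hc.pos.le (by positivity)).trans (h1 hτ)
  have hΦsub : ∀ k, ∀ r ∈ Icc t T, ∀ s ∈ Icc t T,
      (∫ τ in t..s, (c.runningCost G (Y k τ) (V k τ) τ - c₀)) -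
        ∫ τ in t..r, (c.runningCost G (Y k τ) (V k τ) τ - c₀) =
      ∫ τ in r..s, (c.runningCost G (Y k τ) (V k τ) τ - c₀) := by
    intro k r hr s hs
    rw [← uIcc_of_le ht.2] at hr hs
    exact intervalIntegral.integral_interval_sub_left
      ((hΦ k).mono_set (uIcc_subset_uIcc_left hs)) ((hΦ k).mono_set (uIcc_subset_uIcc_left hr))
  have hΦpos : ∀ k, ∀ r ∈ Icc t T, ∀ s ∈ Icc t T, r ≤ s →
      0 ≤ ∫ τ in r..s, (c.runningCost G (Y k τ) (V k τ) τ - c₀) := by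
    intro k r hr s hs hrs
    refine intervalIntegral.integral_nonneg_of_ae_restrict hrs ?_
    rw [Filter.EventuallyLE, ← restrict_Ioo_eq_restrict_Icc]
    refine (ae_restrict_iff' measurableSet_Ioo).2 ?_
    filter_upwards [hΦ0 k] with τ h1 hτ
    exact h1 ⟨hr.1.trans_lt hτ.1, hτ.2.trans_le hs.2⟩
  have htI : t ∈ Icc t T := ⟨le_rfl, ht.2⟩
  have hTI : T ∈ Icc t T := ⟨ht.2, le_rfl⟩
  have hΦle : ∀ k, ∀ s ∈ Icc t T,
      ∫ τ in t..s, (c.runningCost G (Y k τ) (V k τ) τ - c₀) ≤ K := by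
    intro k s hs
    have h1 := hΦsub k s hs T hTI
    have h2 := hΦpos k s hs T hTI hs.2
    linarith [hK k]
  -- pointwise limits along the ultrafilter
  have hFex : ∀ s, ∃ l : ℝ, s ∈ Icc t T → Tendsto (fun k => ∫ τ in t..s,
      (c.runningCost G (Y k τ) (V k τ) τ - c₀)) 𝒰 (𝓝 l) := by
    intro s
    by_cases hs : s ∈ Icc t T
    · obtain ⟨l, hl⟩ := exists_tendsto_of_bounded 𝒰 (z := (0 : ℝ)) (R := K)
        (u := fun k => ∫ τ in t..s, (c.runningCost G (Y k τ) (V k τ) τ - c₀)) fun k => by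
          rw [Real.dist_eq, sub_zero, abs_of_nonneg (hΦpos k t htI s hs hs.1)]
          exact hΦle k s hs
      exact ⟨l, fun _ => hl⟩
    · exact ⟨0, fun h => absurd h hs⟩
  choose F hF using hFex
  obtain ⟨Λ, hΛ0, hΛ⟩ := hc.exists_dist_le hG hp ht one_pos
  have hyex : ∀ s, ∃ l, s ∈ Icc t T → Tendsto (fun k => Y k s) 𝒰 (𝓝 l) := by
    intro s
    by_cases hs : s ∈ Icc t T
    · obtain ⟨l, hl⟩ := exists_tendsto_of_bounded 𝒰 (z := x) (R := Λ * (s - t) + 1 * K)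
        (u := fun k => Y k s) fun k => by
          have h1 := hΛ _ _ _ (hY k) t htI s hs hs.1
          rw [(hY k).init, dist_comm] at h1
          linarith [hΦle k s hs]
      exact ⟨l, fun _ => hl⟩
    · exact ⟨0, fun h => absurd h hs⟩
  choose y hy using hyex
  have hymem : MapsTo y (Icc t T) G.carrier := fun r hr =>
    (Network.isClosed_carrier hG).mem_of_tendsto (hy r hr)
      (Eventually.of_forall fun k => (hY k).mapsTo hr)
  have hac : AbsolutelyContinuousOnInterval y t T :=
    absolutelyContinuous_of_tendsto ht.2 hΦ hΦ0 hK (fun δ hδ => by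
      obtain ⟨Λ', h1, h2⟩ := hc.exists_dist_le hG hp ht hδ
      exact ⟨Λ', h1, fun k => h2 _ _ _ (hY k)⟩) hy
  have hmono : MonotoneOn F (Icc t T) := by
    intro r hr s hs hrs
    refine le_of_tendsto_of_tendsto' (hF r hr) (hF s hs) fun k => ?_
    have h1 := hΦsub k r hr s hs
    have h2 := hΦpos k r hr s hs hrs
    linarith
  have hyd : ∀ᵐ s, s ∈ Ioo t T → HasDerivAt y (deriv y s) s := by
    filter_upwards [hac.boundedVariationOn.ae_differentiableAt_of_mem_uIcc] with s h1 hs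
    exact (h1 (by rw [uIcc_of_le ht.2]; exact Ioo_subset_Icc_self hs)).hasDerivAt
  have hFd : ∀ᵐ s, s ∈ Ioo t T → HasDerivAt F (deriv F s) s := by
    filter_upwards [hmono.ae_differentiableWithinAt_of_mem] with s h1 hs
    exact ((h1 (Ioo_subset_Icc_self hs)).differentiableAt (Icc_mem_nhds hs.1 hs.2)).hasDerivAt
  have hvel := Network.ae_isVelocity hG hyd hymem
  have hle : ∀ᵐ s, s ∈ Ioo t T → c.runningCost G (y s) (deriv y s) s - c₀ ≤ deriv F s := by
    filter_upwards [hyd, hFd, hvel] with s h1 h2 h3 hs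
    exact runningCost_le_of_hasDerivAt hc hG hp ht hY hK hy hF hs (h2 hs) (h1 hs) (h3 hs).1
  rw [← uIcc_of_le ht.2] at hmono
  have hFi := hmono.intervalIntegrable_deriv
  have hFi' := (intervalIntegrable_iff_integrableOn_Ioo_of_le ht.2).1 hFi
  -- the velocity of the limit is in `L^p`
  have hnp : ∀ᵐ s, s ∈ Ioo t T → C₀ * ‖deriv y s‖ ^ p ≤ deriv F s := by
    filter_upwards [hle, hvel] with s h1 h2 hs
    have h3 := hc.le_runningCost hG hp (hymem (Ioo_subset_Icc_self hs)) (h2 hs) (τ := s)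
      ⟨ht.1.trans hs.1.le, hs.2.le⟩
    linarith [h1 hs]
  have hmeas : Measurable (deriv y) := measurable_deriv y
  have hint : IntegrableOn (fun s => ‖deriv y s‖ ^ p) (Ioo t T) := by
    refine Integrable.mono' (hFi'.div_const C₀)
      (hmeas.norm.pow_const p).aestronglyMeasurable
      ((ae_restrict_iff' measurableSet_Ioo).2 ?_)
    filter_upwards [hnp] with s h1 hs
    rw [Real.norm_of_nonneg (by positivity), le_div_iff₀ hc.pos, mul_comm]
    exact h1 hs
  have hmem : MemLp (deriv y) (ENNReal.ofReal p) (volume.restrict (Ioo t T)) := by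
    have hp0 : 0 < p := by linarith
    refine (integrable_norm_rpow_iff hmeas.aestronglyMeasurable (by simpa using hp0)
      ENNReal.ofReal_ne_top).1 ?_
    rwa [ENNReal.toReal_ofReal hp0.le]
  have hvi : IntervalIntegrable (deriv y) volume t T :=
    (intervalIntegrable_iff_integrableOn_Ioo_of_le ht.2).2 (hmem.integrable (by
      rw [← ENNReal.ofReal_one]
      exact ENNReal.ofReal_le_ofReal hp.le))
  have hyt : y t = x := by
    refine tendsto_nhds_unique (hy t htI) ?_
    simp only [(hY _).init]
    exact tendsto_const_nhds
  have htr : IsTrajectory G p T t x y (deriv y) :=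
    ⟨isPrimitive_of_absolutelyContinuous hac ht.2 hvi hyd, hmem, hymem, hyt⟩
  refine ⟨y, deriv y, htr, hy T hTI, F T, hF T hTI, ?_⟩
  have hFt : F t = 0 := by
    refine tendsto_nhds_unique (hF t htI) ?_
    simp only [intervalIntegral.integral_same]
    exact tendsto_const_nhds
  -- `F` may jump or have a singular part, so only `∫ F' ≤ F T - F t` is available; this is the
  -- direction needed.
  have h1 := hmono.intervalIntegral_deriv_mem_uIcc
  have hFT : 0 ≤ F T - F t := sub_nonneg.2 (hmono left_mem_uIcc right_mem_uIcc ht.2)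
  rw [uIcc_of_le hFT, hFt, sub_zero] at h1
  refine le_trans ?_ h1.2
  refine intervalIntegral.integral_mono_ae_restrict ht.2
    (htr.intervalIntegrable_excess hc hG hp ht) hFi ?_
  rw [Filter.EventuallyLE, ← restrict_Ioo_eq_restrict_Icc]
  exact (ae_restrict_iff' measurableSet_Ioo).2 hle

theorem CostBounds.optimal_nonempty (hc : CostBounds c G p T C₀ c₀) (hG : G.Valid) (hp : 1 < p)
    (ht : t ∈ Icc 0 T) (hx : x ∈ G.carrier) :
    (optimal G.carrier (c.runningCost G) (c.terminalCost G) p T t x).Nonempty := by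
  set u := value G.carrier (c.runningCost G) (c.terminalCost G) p T x t with hu
  have hbdd := (hc.integrableOn_and_bddBelow (x := x) hG hp ht).2
  have hne : (cost (c.runningCost G) (c.terminalCost G) T t ''
      admissible G.carrier p T t x).Nonempty :=
    ⟨_, mem_image_of_mem _ ((isTrajectory_const hx).mem_admissible ht.2)⟩
  obtain ⟨w, -, hwlim, hw⟩ := exists_seq_tendsto_sInf hne hbdd
  choose Y hYadm hYcost using hw
  have hY := fun k => isTrajectory_weakDeriv hp ht.2 (hYadm k)
  obtain ⟨B, hB0, hB⟩ := hc.exists_abs_terminalCost_le hG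
  obtain ⟨W, hW⟩ := hwlim.bddAbove_range
  have hTI : T ∈ Icc t T := ⟨ht.2, le_rfl⟩
  have hcost : ∀ k, (∫ τ in t..T, (c.runningCost G (Y k τ) (weakDeriv t T (Y k) τ) τ - c₀)) +
      c₀ * (T - t) + c.terminalCost G (Y k T) = w k := by
    intro k
    rw [(hY k).integral_excess hc hG hp ht, ← hYcost k, (hY k).cost_eq ht.2]
    ring
  obtain ⟨y, v, htr, hyT, F, hF, hle⟩ := exists_trajectory_le hc hG hp ht hY
    (K := W - c₀ * (T - t) + B) (fun k => by
      have h1 := hcost k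
      have h2 := hW (mem_range_self k)
      have h3 := (abs_le.1 (hB _ ((hY k).mapsTo hTI))).1
      linarith) (hyperfilter ℕ)
  refine ⟨y, htr.mem_admissible ht.2, le_antisymm ?_ ?_⟩
  · have hwlim' : Tendsto w (hyperfilter ℕ) (𝓝 u) :=
      hwlim.mono_left (Nat.hyperfilter_le_atTop)
    -- The total and the running costs converge, hence so do the terminal costs, even though the
    -- terminal cost may be discontinuous. Lower semicontinuity compares their limit with the value
    -- at `y T`.
    have hg : Tendsto (fun k => c.terminalCost G (Y k T)) (hyperfilter ℕ)
        (𝓝 (u - F - c₀ * (T - t))) := by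
      refine ((hwlim'.sub hF).sub_const (c₀ * (T - t))).congr fun k => ?_
      have := hcost k
      linarith
    have hg' : c.terminalCost G (y T) ≤ u - F - c₀ * (T - t) := by
      refine le_of_forall_pos_le_add fun ε hε => ?_
      have h1 := ge_of_tendsto hg (b := c.terminalCost G (y T) - ε) (by
        filter_upwards [hyT.eventually (hc.eventually_le_terminalCost hG (y T) hε)] with k hk
        exact hk ((hY k).mapsTo hTI))
      linarith
    rw [htr.cost_eq ht.2]
    rw [htr.integral_excess hc hG hp ht] at hle
    linarith
  · exact csInf_le hbdd (mem_image_of_mem _ (htr.mem_admissible ht.2))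

/-! ### The main result for networks -/

theorem network_control_main {p T : ℝ} (hp : 1 < p) (hT : 0 < T) {d n m : ℕ}
    {G : Network d n m} (hG : G.Valid) {c : NetworkCosts n m} (hc : c.Assumptions G p T) :
    (∀ x ∈ G.carrier, ∀ t ∈ Icc 0 T,
      (∀ y ∈ admissible G.carrier p T t x,
        IntegrableOn (fun τ => c.runningCost G (y τ) (weakDeriv t T y τ) τ) (Ioo t T)) ∧
      BddBelow (cost (c.runningCost G) (c.terminalCost G) T t ''
        admissible G.carrier p T t x)) ∧
    (∀ x ∈ G.carrier, ∀ t ∈ Icc 0 T,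
      (optimal G.carrier (c.runningCost G) (c.terminalCost G) p T t x).Nonempty) ∧
    ∃ M R : ℝ → ℝ, (∀ r, 0 ≤ r → 0 < M r ∧ 0 < R r) ∧
      ∀ x ∈ G.carrier, ∀ t ∈ Icc 0 T,
        ∀ y ∈ optimal G.carrier (c.runningCost G) (c.terminalCost G) p T t x,
          normW1p p t T y ≤ ENNReal.ofReal (M ‖x‖) ∧ ∀ s ∈ Icc t T, ‖y s‖ ≤ R ‖x‖ := by
  obtain ⟨C₀, c₀, h⟩ := hc.exists_costBounds
  refine ⟨fun x _ t ht => h.integrableOn_and_bddBelow hG hp ht,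
    fun x hx t ht => h.optimal_nonempty hG hp ht hx, ?_⟩
  have h1 : ∀ r : ℝ, ∃ M R : ℝ, 0 ≤ r → 0 < M ∧ 0 < R ∧ ∀ x ∈ G.carrier, ‖x‖ ≤ r →
      ∀ t ∈ Icc 0 T, ∀ y ∈ optimal G.carrier (c.runningCost G) (c.terminalCost G) p T t x,
        normW1p p t T y ≤ ENNReal.ofReal M ∧ ∀ s ∈ Icc t T, ‖y s‖ ≤ R := by
    intro r
    by_cases hr : 0 ≤ r
    · obtain ⟨M, R, h2⟩ := h.exists_bounds hG hp hT hr
      exact ⟨M, R, fun _ => h2⟩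
    · exact ⟨0, 0, fun h2 => absurd h2 hr⟩
  choose M R hMR using h1
  exact ⟨M, R, fun r hr => ⟨(hMR r hr).1, (hMR r hr).2.1⟩,
    fun x hx => (hMR ‖x‖ (norm_nonneg x)).2.2 x hx le_rfl⟩

/-! ### The junction as a network -/

/-- The junction with `N` edges, as a network with one vertex. -/
noncomputable def junctionNetwork (N : ℕ) : Network N 1 N where
  vertex _ := 0
  src _ := 0
  dir i := EuclideanSpace.single i 1
  len _ := ∞

/-- The costs on the junction, as costs on a network. -/
def JunctionCosts.toNetworkCosts {N : ℕ} (c : JunctionCosts N) : NetworkCosts 1 N where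
  ℓ := c.ℓ
  ℓstar _ := c.ℓstar
  g := c.g
  gstar _ := c.gstar

section Junction

variable {N : ℕ}

theorem junctionNetwork_param (i : Fin N) (s : ℝ) :
    (junctionNetwork N).param i s = EuclideanSpace.single i s := by
  ext k
  by_cases h : k = i <;> simp [junctionNetwork, Network.param, h]

theorem junctionNetwork_dom (i : Fin N) : (junctionNetwork N).dom i = Ici 0 := by
  ext s
  simp [junctionNetwork, Network.dom]

theorem junctionNetwork_edge (i : Fin N) : (junctionNetwork N).edge i = junctionEdge i := by
  ext z
  simp only [Network.edge, junctionEdge, junctionNetwork_dom, mem_image, junctionNetwork_param,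
    mem_Ici, mem_ofPred_eq]
  exact exists_congr fun r => and_congr_right fun _ => eq_comm

theorem junctionNetwork_carrier : (junctionNetwork N).carrier = junction N := by
  simp only [Network.carrier, junction, junctionNetwork_edge]

theorem zero_mem_junctionEdge (i : Fin N) : (0 : EuclideanSpace ℝ (Fin N)) ∈ junctionEdge i :=
  ⟨0, le_rfl, by ext k; simp⟩

theorem junctionEdge_inter {i j : Fin N} (hij : i ≠ j) :
    junctionEdge i ∩ junctionEdge j = {(0 : EuclideanSpace ℝ (Fin N))} := by
  refine Subset.antisymm ?_ (singleton_subset_iff.2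
    ⟨zero_mem_junctionEdge i, zero_mem_junctionEdge j⟩)
  rintro z ⟨⟨r, -, rfl⟩, ⟨s, -, hs⟩⟩
  have := congrArg (fun z : EuclideanSpace ℝ (Fin N) => z i) hs
  beta_reduce at this
  rw [PiLp.single_apply, PiLp.single_apply, if_pos rfl, if_neg hij] at this
  simp [this]

theorem junctionNetwork_valid (hN : 0 < N) : (junctionNetwork N).Valid where
  vertex_injective := Function.injective_of_subsingleton _
  vertex_mem k := by
    rw [junctionNetwork_carrier]
    exact mem_iUnion.2 ⟨⟨0, hN⟩, zero_mem_junctionEdge _⟩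
  norm_dir i := by simp [junctionNetwork]
  len_pos i := by simp [junctionNetwork]
  exists_end i h := absurd rfl h
  inter_edge i j hij := Or.inr ⟨0, by
    rw [junctionNetwork_edge, junctionNetwork_edge, junctionEdge_inter hij]; rfl⟩
  connected := by
    refine ⟨⟨0, mem_iUnion.2 ⟨⟨0, hN⟩, ?_⟩⟩, ?_⟩
    · rw [junctionNetwork_edge]
      exact zero_mem_junctionEdge _
    · refine isPreconnected_iUnion ⟨0, mem_iInter.2 fun i => ?_⟩ fun i => ?_
      · rw [junctionNetwork_edge]
        exact zero_mem_junctionEdge i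
      · rw [Network.edge, junctionNetwork_dom]
        exact isPreconnected_Ici.image _ ((junctionNetwork N).continuous_param i).continuousOn

theorem junctionNetwork_range_vertex : range (junctionNetwork N).vertex = {0} :=
  range_const

theorem junctionNetwork_coord (i : Fin N) (z : EuclideanSpace ℝ (Fin N)) :
    (junctionNetwork N).coord i z = z i := by
  simp [junctionNetwork, Network.coord, EuclideanSpace.inner_single_left]

theorem coord_eq_norm {i : Fin N} {z : EuclideanSpace ℝ (Fin N)} (hz : z ∈ junctionEdge i) :
    z i = ‖z‖ := by
  obtain ⟨r, hr, rfl⟩ := hz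
  simp [abs_of_nonneg hr]

/-- Every edge of the junction contains the vertex, so the restriction on the index is void. -/
theorem iInf_junctionNetwork (f : Fin N → ℝ) :
    ⨅ i : {i : Fin N // (junctionNetwork N).vertex 0 ∈ (junctionNetwork N).edge i}, f i.1 =
      ⨅ i, f i :=
  (Equiv.subtypeUnivEquiv fun i => by
    rw [junctionNetwork_edge]; exact zero_mem_junctionEdge i).iInf_congr fun _ => rfl

theorem junctionNetwork_coord_vertex (i : Fin N) (j : Fin 1) :
    (junctionNetwork N).coord i ((junctionNetwork N).vertex j) = 0 := by
  rw [junctionNetwork_coord]; rfl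

/-- On the edge `J_i` the arc length coordinate, the `i`-th coordinate and the norm agree. -/
theorem JunctionCosts.runningCost_toNetworkCosts (c : JunctionCosts N) :
    c.toNetworkCosts.runningCost (junctionNetwork N) = c.runningCost := by
  funext z a τ
  rw [NetworkCosts.runningCost, JunctionCosts.runningCost, Fin.sum_univ_one,
    junctionNetwork_range_vertex]
  congr 1
  · refine Finset.sum_congr rfl fun i _ => ?_
    rw [junctionNetwork_edge]
    by_cases hz : z ∈ junctionEdge i \ {0}
    · rw [indicator_of_mem hz, indicator_of_mem hz, junctionNetwork_coord, coord_eq_norm hz.1]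
      simp [junctionNetwork, toNetworkCosts, EuclideanSpace.inner_single_left]
    · rw [indicator_of_notMem hz, indicator_of_notMem hz]
  · have h1 : c.toNetworkCosts.vertexCost (junctionNetwork N) 0 τ = c.vertexCost τ := by
      rw [NetworkCosts.vertexCost, JunctionCosts.vertexCost]
      simp only [junctionNetwork_coord_vertex]
      exact congrArg _ (iInf_junctionNetwork fun i => c.ℓ i 0 0 τ)
    rw [h1]
    rfl

theorem JunctionCosts.terminalCost_toNetworkCosts (c : JunctionCosts N) :
    c.toNetworkCosts.terminalCost (junctionNetwork N) = c.terminalCost := by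
  funext z
  rw [NetworkCosts.terminalCost, JunctionCosts.terminalCost, Fin.sum_univ_one,
    junctionNetwork_range_vertex]
  congr 1
  · refine Finset.sum_congr rfl fun i _ => ?_
    rw [junctionNetwork_edge]
    by_cases hz : z ∈ junctionEdge i \ {0}
    · rw [indicator_of_mem hz, indicator_of_mem hz, junctionNetwork_coord, coord_eq_norm hz.1]
      rfl
    · rw [indicator_of_notMem hz, indicator_of_notMem hz]
  · simp only [junctionNetwork_coord_vertex]
    rw [iInf_junctionNetwork fun i => c.toNetworkCosts.g i 0]
    rfl

theorem JunctionCosts.Assumptions.toNetworkCosts {c : JunctionCosts N} {p T : ℝ}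
    (h : c.Assumptions p T) : c.toNetworkCosts.Assumptions (junctionNetwork N) p T where
  edge := by
    obtain ⟨C₀, c₀, h1, h2, h3⟩ := h.edge
    refine ⟨C₀, c₀, h1, fun i => ?_, fun _ => h3⟩
    rw [junctionNetwork_dom]
    exact h2 i
  star _ := h.star
  terminal i := by
    rw [junctionNetwork_dom]
    exact h.terminal i

end Junction

end NetControl

theorem mainTheorem2 (p T : ℝ) (hp : 1 < p) (hT : 0 < T) :
    -- the junction
    (∀ (N : ℕ), 1 < N → ∀ c : JunctionCosts N, c.Assumptions p T →
      -- every admissible trajectory has a well-defined cost, and `u(x, t)` is finite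
      (∀ x ∈ junction N, ∀ t ∈ Icc 0 T,
        (∀ y ∈ admissible (junction N) p T t x,
          IntegrableOn (fun τ => c.runningCost (y τ) (weakDeriv t T y τ) τ) (Ioo t T)) ∧
        BddBelow (cost c.runningCost c.terminalCost T t '' admissible (junction N) p T t x)) ∧
      -- there is an optimal trajectory
      (∀ x ∈ junction N, ∀ t ∈ Icc 0 T,
        (optimal (junction N) c.runningCost c.terminalCost p T t x).Nonempty) ∧
      -- bounds on the optimal trajectories
      ∃ M R : ℝ → ℝ, (∀ r, 0 ≤ r → 0 < M r ∧ 0 < R r) ∧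
        ∀ x ∈ junction N, ∀ t ∈ Icc 0 T,
          ∀ y ∈ optimal (junction N) c.runningCost c.terminalCost p T t x,
            normW1p p t T y ≤ ENNReal.ofReal (M ‖x‖) ∧ ∀ s ∈ Icc t T, ‖y s‖ ≤ R ‖x‖) ∧
    -- general networks
    (∀ (d n m : ℕ) (G : Network d n m), G.Valid → ∀ c : NetworkCosts n m, c.Assumptions G p T →
      (∀ x ∈ G.carrier, ∀ t ∈ Icc 0 T,
        (∀ y ∈ admissible G.carrier p T t x,
          IntegrableOn (fun τ => c.runningCost G (y τ) (weakDeriv t T y τ) τ) (Ioo t T)) ∧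
        BddBelow (cost (c.runningCost G) (c.terminalCost G) T t ''
          admissible G.carrier p T t x)) ∧
      (∀ x ∈ G.carrier, ∀ t ∈ Icc 0 T,
        (optimal G.carrier (c.runningCost G) (c.terminalCost G) p T t x).Nonempty) ∧
      ∃ M R : ℝ → ℝ, (∀ r, 0 ≤ r → 0 < M r ∧ 0 < R r) ∧
        ∀ x ∈ G.carrier, ∀ t ∈ Icc 0 T,
          ∀ y ∈ optimal G.carrier (c.runningCost G) (c.terminalCost G) p T t x,
            normW1p p t T y ≤ ENNReal.ofReal (M ‖x‖) ∧ ∀ s ∈ Icc t T, ‖y s‖ ≤ R ‖x‖) := by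

  refine ⟨fun N hN c hc => ?_, fun d n m G hG c hc => network_control_main hp hT hG hc⟩
  have h := network_control_main hp hT (junctionNetwork_valid (zero_lt_one.trans hN))
    hc.toNetworkCosts
  rwa [junctionNetwork_carrier, c.runningCost_toNetworkCosts, c.terminalCost_toNetworkCosts] at h
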